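/- \textbf{Setting.} A decentralized saddle point problem with $M$ nodes on $\mathbb R^n\times\mathbb R^n$ is $\min_x\max_y f(x,y)$, $f=\frac1M\sum_{m=1}^M f_m$, with differentiable $f_m:\mathbb R^n\times\mathbb R^n\to\mathbb R$ held by node $m$. Put $F_m(z)=(\nabla_x f_m(x,y),-\nabla_y f_m(x,y))$ for $z=(x,y)$, and $F=\frac1M\sum_m F_m$. The function $f$ is $L$-smooth if $\|F(z_1)-F(z_2)\|\le L\|z_1-z_2\|$ for all $z_1,z_2$, and $\mu$-strongly-convex–strongly-concave if $\langle F(z_1)-F(z_2),z_1-z_2\rangle\ge\mu\|z_1-z_2\|^2$ for all $z_1,z_2$; each $f_m$ is $L_{\max}$-smooth for some finite $L_{\max}$ (the same inequality for $F_m$). The problem is called bilinear if every $f_m$ has the form $f_m(x,y)=\langle x,A_my\rangle+\frac\mu2\|x\|^2-\frac\mu2\|y\|^2+\langle a_m,x\rangle+\langle b_m,y\rangle$. A gossip matrix of a graph $G=(\{1,\dots,M\},E)$ is a symmetric positive semidefinite $W\in\mathbb R^{M\times M}$ with $W_{ij}=0$ whenever $i\ne j$ and $(i,j)\notin E$, and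 $\ker W=\operatorname{span}(\mathbf 1)$; its condition number is the ratio of its largest eigenvalue to its smallest positive eigenvalue. A black-box procedure on graphs $(G^k)_{k\ge0}$ keeps at each node $m$ memories $\mathcal M^x_m,\mathcal M^y_m\subseteq\mathbb R^n$, initially $\{0\}$, and performs, in any order, local iterations and communication rounds. In a local iteration each node adds to its memories finitely many points $x\in\operatorname{span}\{x',\nabla_xf_m(x'',y'')\}$ and $y\in\operatorname{span}\{y',\nabla_yf_m(x'',y'')\}$ with $x',x''\in\mathcal M^x_m$, $y',y''\in\mathcal M^y_m$. In communication round $k=0,1,2,\dots$ each node $m$ replaces $\mathcal M^x_m$ by a set that contains $\operatorname{span}\bigcup_{i}\mathcal M^x_i$, the union being over the neighbours $i$ of $m$ in $G^k$, and is contained in $\operatorname{span}(\mathcal M^x_m\cup\bigcup_{i}\mathcal M^x_i)$ (so that a node may or may not keep its own memory), and likewise for $y$. An output is any pair $(\hat x,\hat y)$ with $\hat x\in\operatorname{span}\bigcup_m\mathcal M^x_m$ and $\hat y\in\operatorname{span}\bigcup_m\mathcal M^y_m$. The starting point is $x_0=y_0=0$. \textbf{Theorem.} There is an absolute constant $c>0$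 such that for any $L>\mu>0$ and any $\chi\ge1$ there exist a number of nodes $M$, a sequence of graphs $(G^k)_{k\ge0}$ on $\{1,\dots,M\}$ whose consecutive members differ in at most two edges (edges added and edges removed are both counted), gossip matrices $W^k$ of $G^k$, each with condition number $\chi$, and, for every $n\ge1$, a bilinear decentralized saddle point problem on $\mathbb R^n\times\mathbb R^n$ with these $M$ nodes, whose global objective is $L$-smooth and $\mu$-strongly-convex–strongly-concave and whose saddle point $(x^*,y^*)=(x^*_n,y^*_n)$ satisfies $x^*\ne0$, $y^*\ne0$, such that the following holds. For every $K\ge0$ there is $n_0$ such that, for every $n\ge n_0$, every output $(\hat x,\hat y)$ of every black-box procedure applied to the $n$-th problem over $(G^k)$, after $K$ communication rounds and any number of local iterations, satisfies \[\|\hat x-x^*\|^2+\|\hat y-y^*\|^2\;\ge\; c\,\exp\Bigl(-\frac{32\mu}{L-\mu}\cdot\frac K\chi\Bigr)\,\|y_0-y^*\|^2 .\] -/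

import Mathlib

open scoped InnerProductSpace

noncomputable section

namespace DecentralizedSaddle

/-- Euclidean space `ℝⁿ` (with the Euclidean norm). -/
abbrev E (n : ℕ) : Type := EuclideanSpace ℝ (Fin n)

/-- The space `ℝⁿ × ℝⁿ` of pairs `z = (x, y)`, with `‖z‖² = ‖x‖² + ‖y‖²`. -/
abbrev Z (n : ℕ) : Type := WithLp 2 (E n × E n)

/-- A decentralized saddle point problem `min_x max_y (1/M) ∑ₘ fₘ(x, y)` on `ℝⁿ × ℝⁿ` with `M`
nodes is given by the family of its local objectives `f₁, …, f_M`. -/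
abbrev Problem (M n : ℕ) : Type := Fin M → E n → E n → ℝ

/-! ### Saddle point problems -/

/-- Partial gradient in `x`. -/
def gradX {n : ℕ} (g : E n → E n → ℝ) (x y : E n) : E n := gradient (fun u => g u y) x

/-- Partial gradient in `y`. -/
def gradY {n : ℕ} (g : E n → E n → ℝ) (x y : E n) : E n := gradient (fun v => g x v) y

/-- The global objective `f = (1/M) ∑ₘ fₘ`. -/
def globalObjective {M n : ℕ} (f : Problem M n) (x y : E n) : ℝ :=
  (1 / (M : ℝ)) * ∑ m, f m x y

/-- The operator `Fₘ(z) = (∇ₓ fₘ(x, y), -∇_y fₘ(x, y))` of a local objective. -/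
def localOperator {n : ℕ} (g : E n → E n → ℝ) (z : Z n) : Z n :=
  WithLp.toLp 2 (gradX g z.fst z.snd, -gradY g z.fst z.snd)

/-- The operator `F = (1/M) ∑ₘ Fₘ` of the problem. -/
def globalOperator {M n : ℕ} (f : Problem M n) (z : Z n) : Z n :=
  (1 / (M : ℝ)) • ∑ m, localOperator (f m) z

/-- The standing regularity assumption: the local objectives are differentiable, the global
objective is `L`-smooth and `μ`-strongly-convex-strongly-concave, and the local objectives are
`Lmax`-smooth for a common finite constant `Lmax`. -/
structure IsRegular {M n : ℕ} (f : Problem M n) (L μ : ℝ) : Prop where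
  differentiable : ∀ m, Differentiable ℝ (fun z : E n × E n => f m z.1 z.2)
  smooth : ∀ z₁ z₂ : Z n, ‖globalOperator f z₁ - globalOperator f z₂‖ ≤ L * ‖z₁ - z₂‖
  smooth_local : ∃ Lmax : ℝ, ∀ m, ∀ z₁ z₂ : Z n,
    ‖localOperator (f m) z₁ - localOperator (f m) z₂‖ ≤ Lmax * ‖z₁ - z₂‖
  strongly_monotone : ∀ z₁ z₂ : Z n,
    μ * ‖z₁ - z₂‖ ^ 2 ≤ ⟪globalOperator f z₁ - globalOperator f z₂, z₁ - z₂⟫_ℝ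

/-- The problem is bilinear, with quadratic regularization of strength `μ`:
`fₘ(x, y) = ⟨x, Aₘ y⟩ + (μ/2)‖x‖² - (μ/2)‖y‖² + ⟨aₘ, x⟩ + ⟨bₘ, y⟩`. -/
def IsBilinear {M n : ℕ} (f : Problem M n) (μ : ℝ) : Prop :=
  ∀ m, ∃ (A : E n →L[ℝ] E n) (a b : E n), ∀ x y : E n,
    f m x y = ⟪x, A y⟫_ℝ + μ / 2 * ‖x‖ ^ 2 - μ / 2 * ‖y‖ ^ 2 + ⟪a, x⟫_ℝ + ⟪b, y⟫_ℝ

/-- `(xs, ys)` is a saddle point of the global objective, i.e. a solution of the problem. -/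
def IsSaddlePoint {M n : ℕ} (f : Problem M n) (xs ys : E n) : Prop :=
  ∀ x y : E n, globalObjective f xs y ≤ globalObjective f xs ys ∧
    globalObjective f xs ys ≤ globalObjective f x ys

/-! ### Networks -/

/-- `W` is a gossip matrix of the graph `G`. (`Matrix.PosSemidef` includes symmetry.) -/
structure IsGossipMatrix {M : ℕ} (G : SimpleGraph (Fin M)) (W : Matrix (Fin M) (Fin M) ℝ) :
    Prop where
  posSemidef : W.PosSemidef
  eq_zero_of_not_adj : ∀ i j, i ≠ j → ¬ G.Adj i j → W i j = 0
  ker_eq : LinearMap.ker (Matrix.toLin' W) = Submodule.span ℝ {(1 : Fin M → ℝ)}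

/-- `χ` is the condition number `λ_max(W) / λ_min⁺(W)` of `W`: the ratio of the largest eigenvalue
and the smallest positive one. -/
def HasConditionNumber {M : ℕ} (W : Matrix (Fin M) (Fin M) ℝ) (χ : ℝ) : Prop :=
  ∃ lmax lmin : ℝ,
    IsGreatest {l : ℝ | Module.End.HasEigenvalue (Matrix.toLin' W) l} lmax ∧
    IsLeast {l : ℝ | 0 < l ∧ Module.End.HasEigenvalue (Matrix.toLin' W) l} lmin ∧
    χ = lmax / lmin

/-- Two graphs differ in at most `r` edges (edges added and edges removed are both counted). -/
def DifferInAtMost {M : ℕ} (r : ℕ) (G H : SimpleGraph (Fin M)) : Prop :=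
  (symmDiff G.edgeSet H.edgeSet).ncard ≤ r

/-! ### Black-box procedures -/

/-- The local memories of all nodes. -/
structure Memory (M n : ℕ) where
  /-- memory for the `x`-variables -/
  memX : Fin M → Set (E n)
  /-- memory for the `y`-variables -/
  memY : Fin M → Set (E n)

/-- Initially all memories are `{0}`. -/
def Memory.initial (M n : ℕ) : Memory M n := ⟨fun _ => {0}, fun _ => {0}⟩

/-- A local iteration: each node `m` adds to its memories finitely many points
`x ∈ span {x', ∇ₓ fₘ(x'', y'')}` and `y ∈ span {y', ∇_y fₘ(x'', y'')}`, where `x', x''` and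
`y', y''` are in its memories. -/
def LocalStep {M n : ℕ} (f : Problem M n) (s s' : Memory M n) : Prop :=
  ∀ m, ∃ X Y : Finset (E n),
    s'.memX m = s.memX m ∪ (X : Set (E n)) ∧
    s'.memY m = s.memY m ∪ (Y : Set (E n)) ∧
    (∀ x ∈ X, ∃ x' ∈ s.memX m, ∃ x'' ∈ s.memX m, ∃ y'' ∈ s.memY m,
      x ∈ Submodule.span ℝ {x', gradX (f m) x'' y''}) ∧
    (∀ y ∈ Y, ∃ y' ∈ s.memY m, ∃ x'' ∈ s.memX m, ∃ y'' ∈ s.memY m,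
      y ∈ Submodule.span ℝ {y', gradY (f m) x'' y''})

/-- `S'` arises from the memories `S` by one communication round over `G`: every node receives the
span of the memories of its neighbours. The node may keep its own memory (the upper bound), or be
left with what it received (the lower bound); both conventions are instances. -/
def Communicates {M n : ℕ} (G : SimpleGraph (Fin M)) (S S' : Fin M → Set (E n)) : Prop :=
  ∀ m, (Submodule.span ℝ (⋃ i ∈ G.neighborSet m, S i) : Set (E n)) ⊆ S' m ∧
    S' m ⊆ (Submodule.span ℝ (S m ∪ ⋃ i ∈ G.neighborSet m, S i) : Set (E n))

/-- A communication round over `G`. -/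
def CommStep {M n : ℕ} (G : SimpleGraph (Fin M)) (s s' : Memory M n) : Prop :=
  Communicates G s.memX s'.memX ∧ Communicates G s.memY s'.memY

/-- `BBP G f T K s`: some black-box procedure has the memories `s` after `T` local iterations and
`K` communication rounds, interleaved in any order. Round `k = 0, 1, 2, …` takes place over the
graph `G k`. -/
inductive BBP {M n : ℕ} (G : ℕ → SimpleGraph (Fin M)) (f : Problem M n) :
    ℕ → ℕ → Memory M n → Prop
  | initial : BBP G f 0 0 (Memory.initial M n)
  | localStep {T K : ℕ} {s s' : Memory M n} :
      BBP G f T K s → LocalStep f s s' → BBP G f (T + 1) K s'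
  | commStep {T K : ℕ} {s s' : Memory M n} :
      BBP G f T K s → CommStep (G K) s s' → BBP G f T (K + 1) s'

/-- The admissible outputs `(xh, yh)` of a procedure with memories `s`. -/
def IsOutput {M n : ℕ} (s : Memory M n) (xh yh : E n) : Prop :=
  xh ∈ Submodule.span ℝ (⋃ m, s.memX m) ∧ yh ∈ Submodule.span ℝ (⋃ m, s.memY m)

end DecentralizedSaddle

end

namespace DecentralizedSaddle

open Matrix

/-! The global objective couples x and y through ρ(I − S), with S the shift, and has a linear term
in the first x-coordinate only. In the order x₀, y₀, x₁, y₁, … this is a chain: S produces x_i from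
y_{i−1}, the identity produces y_i from x_i. One hub of the network holds S and the linear term, the
other hub holds the identity. Consecutive coordinates are thus unlocked by different hubs, and
unlimited local work gains nothing until information has crossed from one hub to the other.

The moving network makes a crossing slow. Each leaf hangs on one hub, except for one connector that
hangs on both. During a sweep the connector runs through the m leaves just ahead of the information:
a leaf that has been informed by the leading hub loses its edge to the other hub before it can pass
anything on. The next sweep runs backwards with the hubs exchanged. Hence K rounds unlock at most
K/m + 1 coordinates of the chain (`infoBound_succ_of_adj_or_eq`, `BBP.memory_subset`,
`hardProblem_output`).

The saddle point is explicit, with coordinates decaying like q^i for q = (L − μ)/(L + μ). An output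
whose y-part has only N unlocked coordinates misses a fraction of order q^(2N) of ‖y*‖²
(`saddleY_tail`), and `exp_le_rate` compares this with the exponential.

It remains to have m of order χ. Putting a weight of order m on the two edges at the connector gives
a Laplacian of condition number at most 8m − 4. Raising the weight of one edge then drives the
condition number continuously past every larger value, so χ is attained exactly
(`exists_isGossipMatrix_hasConditionNumber`, `exists_gossipMatrix_network`). -/

/-! ### Gossip matrices with a prescribed condition number. -/

lemma isCompact_dotProduct_self_eq_one (M : ℕ) : IsCompact {x : Fin M → ℝ | x ⬝ᵥ x = 1} := by
  refine Metric.isCompact_of_isClosed_isBounded ?_ ?_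
  · exact isClosed_eq (by unfold dotProduct; fun_prop) continuous_const
  · refine (Metric.isBounded_closedBall (x := (0 : Fin M → ℝ)) (r := 1)).subset fun x hx => ?_
    rw [mem_closedBall_zero_iff, pi_norm_le_iff_of_nonneg zero_le_one]
    intro i
    have h : x i * x i ≤ x ⬝ᵥ x :=
      Finset.single_le_sum (f := fun i => x i * x i) (fun i _ => mul_self_nonneg _)
        (Finset.mem_univ i)
    rw [Set.mem_ofPred_eq.mp hx] at h
    rw [Real.norm_eq_abs]
    exact abs_le_one_iff_mul_self_le_one.mpr h

/-- The matrix `(e_a - e_b)(e_a - e_b)ᵀ`. -/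
def edgeMatrix {M : ℕ} (a b : Fin M) : Matrix (Fin M) (Fin M) ℝ :=
  vecMulVec (Pi.single a 1 - Pi.single b 1) (Pi.single a 1 - Pi.single b 1)

lemma edgeMatrix_quadratic {M : ℕ} (a b : Fin M) (x : Fin M → ℝ) :
    x ⬝ᵥ edgeMatrix a b *ᵥ x = (x a - x b) ^ 2 := by
  simp only [edgeMatrix, vecMulVec_mulVec, dotProduct_smul, sub_dotProduct,
    dotProduct_sub, single_one_dotProduct, dotProduct_single_one, MulOpposite.smul_eq_mul_unop,
    MulOpposite.unop_op]
  ring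

lemma edgeMatrix_mulVec_one {M : ℕ} (a b : Fin M) : edgeMatrix a b *ᵥ 1 = 0 := by
  simp [edgeMatrix, vecMulVec_mulVec, sub_dotProduct]

lemma edgeMatrix_posSemidef {M : ℕ} (a b : Fin M) : (edgeMatrix a b).PosSemidef := by
  have h := posSemidef_vecMulVec_self_star (Pi.single a 1 - Pi.single b 1 : Fin M → ℝ)
  simpa [edgeMatrix] using h

lemma edgeMatrix_eq_zero {M : ℕ} {G : SimpleGraph (Fin M)} {a b : Fin M} (h : G.Adj a b)
    (i j : Fin M) (hij : i ≠ j) (hadj : ¬ G.Adj i j) : edgeMatrix a b i j = 0 := by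
  have h1 : ¬ (i = a ∧ j = b) := by rintro ⟨rfl, rfl⟩; exact hadj h
  have h2 : ¬ (i = b ∧ j = a) := by rintro ⟨rfl, rfl⟩; exact hadj h.symm
  have h3 : ¬ (i = a ∧ j = a) := by rintro ⟨rfl, rfl⟩; exact hij rfl
  have h4 : ¬ (i = b ∧ j = b) := by rintro ⟨rfl, rfl⟩; exact hij rfl
  simp only [edgeMatrix, vecMulVec_apply, Pi.sub_apply, Pi.single_apply]
  split_ifs <;> simp_all

lemma dotProduct_mulVec_symm {M : ℕ} {W : Matrix (Fin M) (Fin M) ℝ} (hW : W.PosSemidef)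
    (x y : Fin M → ℝ) : x ⬝ᵥ W *ᵥ y = y ⬝ᵥ W *ᵥ x := by
  have h : Wᵀ = W := by simpa [IsHermitian] using hW.isHermitian
  rw [dotProduct_mulVec, dotProduct_comm, ← mulVec_transpose, h]

lemma dotProduct_sub_mean {M : ℕ} (hM : M ≠ 0) (x : Fin M → ℝ) :
    (x - ((x ⬝ᵥ 1) / M) • (1 : Fin M → ℝ)) ⬝ᵥ 1 = 0 := by
  have : (M : ℝ) ≠ 0 := by exact_mod_cast hM
  simp [sub_dotProduct, smul_dotProduct, this]

/-- Subtracting its mean from a kernel vector leaves a mean-zero kernel vector, which coercivity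
forces to vanish. -/
lemma isGossipMatrix_of_coercive {M : ℕ} {G : SimpleGraph (Fin M)}
    {W : Matrix (Fin M) (Fin M) ℝ} {α : ℝ} (hM : M ≠ 0) (hα : 0 < α) (hW : W.PosSemidef)
    (hz : ∀ i j, i ≠ j → ¬ G.Adj i j → W i j = 0) (hone : W *ᵥ 1 = 0)
    (hlow : ∀ x : Fin M → ℝ, x ⬝ᵥ 1 = 0 → α * (x ⬝ᵥ x) ≤ x ⬝ᵥ W *ᵥ x) :
    IsGossipMatrix G W := by
  refine ⟨hW, hz, le_antisymm ?_ ?_⟩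
  · intro x hx
    rw [LinearMap.mem_ker, toLin'_apply] at hx
    rw [Submodule.mem_span_singleton]
    refine ⟨(x ⬝ᵥ 1) / M, ?_⟩
    set y := x - ((x ⬝ᵥ 1) / M) • (1 : Fin M → ℝ) with hy
    have h1 := hlow y (dotProduct_sub_mean hM x)
    have h2 : W *ᵥ y = 0 := by rw [hy, mulVec_sub, mulVec_smul, hx, hone]; simp
    rw [h2, dotProduct_zero] at h1
    have h3 : y ⬝ᵥ y = 0 :=
      le_antisymm (by nlinarith) (Finset.sum_nonneg fun i _ => mul_self_nonneg _)
    have h4 : y = 0 := dotProduct_self_eq_zero.mp h3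
    rw [hy, sub_eq_zero] at h4
    exact h4.symm
  · rw [Submodule.span_singleton_le_iff_mem, LinearMap.mem_ker, toLin'_apply, hone]

/-- The matrix l − W is positive semidefinite, and a zero of a semidefinite quadratic form lies in
the kernel. -/
lemma mulVec_eq_smul_of_isMax {M : ℕ} {W : Matrix (Fin M) (Fin M) ℝ} (hW : W.PosSemidef) {l : ℝ}
    (hl : ∀ x : Fin M → ℝ, x ⬝ᵥ W *ᵥ x ≤ l * (x ⬝ᵥ x)) {x : Fin M → ℝ}
    (hx : x ⬝ᵥ W *ᵥ x = l * (x ⬝ᵥ x)) : W *ᵥ x = l • x := by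
  have h : (l • (1 : Matrix (Fin M) (Fin M) ℝ) - W).PosSemidef := by
    refine PosSemidef.of_dotProduct_mulVec_nonneg ?_ fun y => ?_
    · exact IsHermitian.sub (by simp [IsHermitian]) hW.isHermitian
    · have := hl y
      simp only [star_trivial, sub_mulVec, smul_mulVec, one_mulVec, dotProduct_sub,
        dotProduct_smul, smul_eq_mul]
      linarith
  have h2 := (h.dotProduct_mulVec_zero_iff x).mp (by
    simp only [star_trivial, sub_mulVec, smul_mulVec, one_mulVec, dotProduct_sub,
        dotProduct_smul, smul_eq_mul]
    linarith)
  rw [sub_mulVec, smul_mulVec, one_mulVec, sub_eq_zero] at h2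
  exact h2.symm

/-- W − l is semidefinite only on mean-zero vectors. Adding (l/M)·11ᵀ cancels the value −l on the
constants and changes nothing on their complement, so the kernel argument applies on the whole
space. -/
lemma mulVec_eq_smul_of_isMin {M : ℕ} (hM : M ≠ 0) {W : Matrix (Fin M) (Fin M) ℝ}
    (hW : W.PosSemidef) (hone : W *ᵥ 1 = 0) {l : ℝ}
    (hl : ∀ x : Fin M → ℝ, x ⬝ᵥ 1 = 0 → l * (x ⬝ᵥ x) ≤ x ⬝ᵥ W *ᵥ x) {x : Fin M → ℝ}
    (hx1 : x ⬝ᵥ 1 = 0) (hx : x ⬝ᵥ W *ᵥ x = l * (x ⬝ᵥ x)) : W *ᵥ x = l • x := by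
  have hM' : (M : ℝ) ≠ 0 := by exact_mod_cast hM
  set N : Matrix (Fin M) (Fin M) ℝ :=
    W - l • (1 : Matrix (Fin M) (Fin M) ℝ) + (l / M) • vecMulVec 1 1 with hN
  have hmul : ∀ y, N *ᵥ y = W *ᵥ y - l • y + ((l / M) * (y ⬝ᵥ 1)) • (1 : Fin M → ℝ) := by
    intro y
    rw [hN, add_mulVec, sub_mulVec, smul_mulVec, smul_mulVec, one_mulVec, vecMulVec_mulVec,
      dotProduct_comm 1 y]
    ext i
    simp
  have h : N.PosSemidef := by
    refine PosSemidef.of_dotProduct_mulVec_nonneg ?_ fun y => ?_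
    · refine (IsHermitian.sub hW.isHermitian (by simp [IsHermitian])).add ?_
      ext i j
      simp
    · rw [star_trivial, hmul]
      set s := (y ⬝ᵥ 1) / M with hs
      obtain ⟨z, hz⟩ : ∃ z, z = y - s • (1 : Fin M → ℝ) := ⟨_, rfl⟩
      have hz1 : z ⬝ᵥ 1 = 0 := hz ▸ dotProduct_sub_mean hM y
      have hyz : y = z + s • (1 : Fin M → ℝ) := by rw [hz]; simp
      have h1 := hl z hz1
      have h1z : (1 : Fin M → ℝ) ⬝ᵥ z = 0 := by rw [dotProduct_comm, hz1]
      have h2 : (1 : Fin M → ℝ) ⬝ᵥ W *ᵥ z = 0 := by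
        rw [dotProduct_mulVec_symm hW, hone, dotProduct_zero]
      have h3 : (1 : Fin M → ℝ) ⬝ᵥ 1 = M := by simp [dotProduct]
      rw [hyz]
      simp only [mulVec_add, mulVec_smul, hone, dotProduct_add, dotProduct_sub, dotProduct_smul,
        add_dotProduct, smul_dotProduct, smul_eq_mul, hz1, h1z, h2, h3, smul_zero, add_zero,
        mul_zero, zero_add]
      have h4 : l / M * (s * M) * (s * M) = l * (s * (s * M)) := by field_simp
      linarith
  have h2 := (h.dotProduct_mulVec_zero_iff x).mp (by
    rw [star_trivial, hmul, hx1]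
    simp [dotProduct_sub, hx])
  rw [hmul, hx1, mul_zero, zero_smul, add_zero, sub_eq_zero] at h2
  exact h2

lemma hasEigenvalue_of_mulVec {M : ℕ} {W : Matrix (Fin M) (Fin M) ℝ} {l : ℝ} {x : Fin M → ℝ}
    (hx : x ⬝ᵥ x = 1) (h : W *ᵥ x = l • x) : Module.End.HasEigenvalue (toLin' W) l := by
  refine Module.End.hasEigenvalue_of_hasEigenvector (x := x) ?_
  rw [Module.End.hasEigenvector_iff, Module.End.mem_eigenspace_iff, toLin'_apply]
  refine ⟨h, ?_⟩
  rintro rfl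
  simp at hx

/-- The condition number, given vectors attaining the extreme Rayleigh quotients. -/
lemma hasConditionNumber_of_extremal {M : ℕ} (hM : M ≠ 0) {W : Matrix (Fin M) (Fin M) ℝ}
    (hW : W.PosSemidef) (hone : W *ᵥ 1 = 0) {lmax lmin : ℝ} (hpos : 0 < lmin)
    (hup : ∀ x : Fin M → ℝ, x ⬝ᵥ W *ᵥ x ≤ lmax * (x ⬝ᵥ x))
    (hlow : ∀ x : Fin M → ℝ, x ⬝ᵥ 1 = 0 → lmin * (x ⬝ᵥ x) ≤ x ⬝ᵥ W *ᵥ x)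
    {x y : Fin M → ℝ} (hx : x ⬝ᵥ x = 1) (hxl : x ⬝ᵥ W *ᵥ x = lmax)
    (hy : y ⬝ᵥ y = 1) (hy1 : y ⬝ᵥ 1 = 0) (hyl : y ⬝ᵥ W *ᵥ y = lmin) :
    HasConditionNumber W (lmax / lmin) := by
  have key : ∀ l, Module.End.HasEigenvalue (toLin' W) l →
      ∃ z : Fin M → ℝ, 0 < z ⬝ᵥ z ∧ W *ᵥ z = l • z := by
    intro l hl
    obtain ⟨z, hz⟩ := hl.exists_hasEigenvector
    rw [Module.End.hasEigenvector_iff, Module.End.mem_eigenspace_iff, toLin'_apply] at hz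
    refine ⟨z, lt_of_le_of_ne (Finset.sum_nonneg fun i _ => mul_self_nonneg _) ?_, hz.1⟩
    exact fun h => hz.2 (dotProduct_self_eq_zero.mp h.symm)
  refine ⟨lmax, lmin, ⟨?_, ?_⟩, ⟨⟨hpos, ?_⟩, ?_⟩, rfl⟩
  · exact hasEigenvalue_of_mulVec hx (mulVec_eq_smul_of_isMax hW hup (by rw [hxl, hx, mul_one]))
  · intro l hl
    obtain ⟨z, hz, hWz⟩ := key l hl
    have h := hup z
    rw [hWz, dotProduct_smul, smul_eq_mul] at h
    exact le_of_mul_le_mul_right h hz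
  · exact hasEigenvalue_of_mulVec hy
      (mulVec_eq_smul_of_isMin hM hW hone hlow hy1 (by rw [hyl, hy, mul_one]))
  · rintro l ⟨hl0, hl⟩
    obtain ⟨z, hz, hWz⟩ := key l hl
    have h1 : z ⬝ᵥ 1 = 0 := by
      have h := dotProduct_mulVec_symm hW 1 z
      rw [hWz, hone, dotProduct_zero, dotProduct_smul, smul_eq_mul, dotProduct_comm] at h
      exact (mul_eq_zero.mp h).resolve_left hl0.ne'
    have h := hlow z h1
    rw [hWz, dotProduct_smul, smul_eq_mul] at h
    exact le_of_mul_le_mul_right h hz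

lemma exists_normalized {M : ℕ} {z : Fin M → ℝ} (hz : z ≠ 0) :
    ∃ s : ℝ, (s • z) ⬝ᵥ (s • z) = 1 := by
  have h0 : 0 < z ⬝ᵥ z := lt_of_le_of_ne (Finset.sum_nonneg fun i _ => mul_self_nonneg _)
    fun h => hz (dotProduct_self_eq_zero.mp h.symm)
  refine ⟨(√(z ⬝ᵥ z))⁻¹, ?_⟩
  rw [dotProduct_smul, smul_dotProduct, smul_eq_mul, smul_eq_mul, ← mul_assoc, ← mul_inv,
    Real.mul_self_sqrt h0.le, inv_mul_cancel₀ h0.ne']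

/-- If the support of a graph carries a gossip matrix of condition number at most `χ`, then it
carries one of condition number exactly `χ`. -/
theorem exists_isGossipMatrix_hasConditionNumber {M : ℕ} {G : SimpleGraph (Fin M)}
    {W₀ : Matrix (Fin M) (Fin M) ℝ} {α β χ : ℝ} (hα : 0 < α) (hχ : 0 ≤ χ) (hβ : β ≤ χ * α)
    (hW : W₀.PosSemidef) (hz : ∀ i j, i ≠ j → ¬ G.Adj i j → W₀ i j = 0) (hone : W₀ *ᵥ 1 = 0)
    (hlow : ∀ x : Fin M → ℝ, x ⬝ᵥ 1 = 0 → α * (x ⬝ᵥ x) ≤ x ⬝ᵥ W₀ *ᵥ x)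
    (hup : ∀ x : Fin M → ℝ, x ⬝ᵥ W₀ *ᵥ x ≤ β * (x ⬝ᵥ x))
    {a b c : Fin M} (hab : G.Adj a b) (hca : c ≠ a) (hcb : c ≠ b) :
    ∃ W, IsGossipMatrix G W ∧ HasConditionNumber W χ := by
  have hM : M ≠ 0 := by rintro rfl; exact a.elim0
  have hba : b ≠ a := hab.ne'
  set S : Set (Fin M → ℝ) := {x | x ⬝ᵥ x = 1} with hS
  set S₁ : Set (Fin M → ℝ) := S ∩ {x | x ⬝ᵥ 1 = 0} with hS₁
  have hSc : IsCompact S := isCompact_dotProduct_self_eq_one M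
  have hS₁c : IsCompact S₁ :=
    hSc.inter_right (isClosed_eq (by unfold dotProduct; fun_prop) continuous_const)
  set φ : ℝ → (Fin M → ℝ) → ℝ := fun t x => x ⬝ᵥ W₀ *ᵥ x + t * (x a - x b) ^ 2 with hφ
  have hφc : Continuous ↿φ := by
    simp only [hφ, Function.HasUncurry.uncurry, id, dotProduct, mulVec]
    fun_prop
  have hφt : ∀ t, Continuous (φ t) := fun t => hφc.comp (by fun_prop : Continuous fun x => (t, x))
  have hφW : ∀ t x, x ⬝ᵥ (W₀ + t • edgeMatrix a b) *ᵥ x = φ t x := by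
    intro t x
    rw [add_mulVec, smul_mulVec, dotProduct_add, dotProduct_smul, edgeMatrix_quadratic, smul_eq_mul]
  -- `u` makes `top t` grow at least like 2t, while the next vector `w`, blind to the edge `a b`,
  -- keeps `bot t` bounded. The third vertex `c` is what allows such a mean-zero `w`.
  obtain ⟨u, huS, huab⟩ : ∃ u ∈ S₁, 2 ≤ (u a - u b) ^ 2 := by
    have h2 : √2 * √2 = (2 : ℝ) := Real.mul_self_sqrt zero_le_two
    refine ⟨(√2 / 2) • (Pi.single a 1 - Pi.single b 1), ⟨?_, ?_⟩, ?_⟩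
    · simp only [hS, Set.mem_ofPred_eq, dotProduct_smul, smul_dotProduct, sub_dotProduct,
        single_one_dotProduct, smul_eq_mul, Pi.sub_apply, Pi.single_eq_same,
        Pi.single_eq_of_ne hba, Pi.single_eq_of_ne hba.symm]
      linarith
    · simp [smul_dotProduct, sub_dotProduct]
    · simp only [Pi.smul_apply, Pi.sub_apply, Pi.single_eq_same, Pi.single_eq_of_ne hba,
        Pi.single_eq_of_ne hba.symm, smul_eq_mul]
      nlinarith
  obtain ⟨w, hwS, hwab⟩ : ∃ w ∈ S₁, w a = w b := by
    set z : Fin M → ℝ := Pi.single a 1 + Pi.single b 1 - (2 : ℝ) • Pi.single c 1 with hzdef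
    have hz0 : z ≠ 0 := by
      intro h
      have := congrFun h c
      simp [hzdef, Pi.single_eq_of_ne hca, Pi.single_eq_of_ne hcb] at this
    obtain ⟨s, hs⟩ := exists_normalized hz0
    refine ⟨s • z, ⟨hs, ?_⟩, ?_⟩
    · simp only [Set.mem_ofPred_eq, smul_dotProduct, hzdef, sub_dotProduct, add_dotProduct,
        single_one_dotProduct, Pi.one_apply, smul_eq_mul]
      ring
    · simp [hzdef, Pi.single_eq_of_ne hba, Pi.single_eq_of_ne hba.symm,
        Pi.single_eq_of_ne hca.symm, Pi.single_eq_of_ne hcb.symm]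
  set top : ℝ → ℝ := fun t => sSup (φ t '' S) with htop
  set bot : ℝ → ℝ := fun t => sInf (φ t '' S₁) with hbot
  have htopc : Continuous top := hSc.continuous_sSup hφc
  have hbotc : Continuous bot := hS₁c.continuous_sInf hφc
  have hle_top : ∀ t, ∀ x ∈ S, φ t x ≤ top t := fun t x hx =>
    le_csSup (hSc.image (hφt t)).bddAbove ⟨x, hx, rfl⟩
  have hbot_le : ∀ t, ∀ x ∈ S₁, bot t ≤ φ t x := fun t x hx =>
    csInf_le (hS₁c.image (hφt t)).bddBelow ⟨x, hx, rfl⟩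
  have hα_le : ∀ t, 0 ≤ t → ∀ x ∈ S₁, α ≤ φ t x := by
    intro t ht x hx
    have h := hlow x hx.2
    rw [Set.mem_ofPred_eq.mp hx.1, mul_one] at h
    have := mul_nonneg ht (sq_nonneg (x a - x b))
    simp only [hφ]
    linarith
  have htop0 : top 0 ≤ β := by
    refine csSup_le ⟨_, u, huS.1, rfl⟩ ?_
    rintro _ ⟨x, hx, rfl⟩
    have h := hup x
    rw [Set.mem_ofPred_eq.mp hx, mul_one] at h
    simpa [hφ] using h
  have hbot0 : ∀ t, 0 ≤ t → α ≤ bot t := by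
    intro t ht
    refine le_csInf ⟨_, u, huS, rfl⟩ ?_
    rintro _ ⟨x, hx, rfl⟩
    exact hα_le t ht x hx
  set C : ℝ := φ 0 w with hC
  have hC0 : 0 ≤ C := hα.le.trans (hα_le 0 le_rfl w hwS)
  have hT0 : 0 ≤ χ * C := mul_nonneg hχ hC0
  -- At t = 0 the difference is at most β − χα ≤ 0. At t = χC it is at least 2χC − χC ≥ 0.
  obtain ⟨t, ⟨ht0, -⟩, ht⟩ : (0 : ℝ) ∈ (fun t => top t - χ * bot t) '' Set.Icc 0 (χ * C) := by
    refine intermediate_value_Icc hT0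
      (htopc.sub (continuous_const.mul hbotc)).continuousOn ⟨?_, ?_⟩
    · have h1 := mul_le_mul_of_nonneg_left (hbot0 0 le_rfl) hχ
      change top 0 - χ * bot 0 ≤ 0
      linarith
    · have h1 := mul_le_mul_of_nonneg_left (hbot_le (χ * C) w hwS) hχ
      have h2 : φ (χ * C) w = C := by simp [hφ, hC, hwab]
      have h3 := hle_top (χ * C) u huS.1
      have h4 : 0 ≤ u ⬝ᵥ W₀ *ᵥ u := by simpa using hW.dotProduct_mulVec_nonneg u
      have h5 := mul_le_mul_of_nonneg_left huab hT0
      simp only [hφ] at h3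
      rw [h2] at h1
      change 0 ≤ top (χ * C) - χ * bot (χ * C)
      linarith
  have hWt : (W₀ + t • edgeMatrix a b).PosSemidef :=
    hW.add ((edgeMatrix_posSemidef a b).smul ht0)
  have honet : (W₀ + t • edgeMatrix a b) *ᵥ 1 = 0 := by
    rw [add_mulVec, smul_mulVec, hone, edgeMatrix_mulVec_one]; simp
  have hscale : ∀ (s : ℝ) (x : Fin M → ℝ), φ t (s • x) = s ^ 2 * φ t x := by
    intro s x
    simp only [hφ, mulVec_smul, dotProduct_smul, smul_dotProduct, smul_eq_mul, Pi.smul_apply]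
    ring
  have hbpos : 0 < bot t := hα.trans_le (hbot0 t ht0)
  refine ⟨W₀ + t • edgeMatrix a b, isGossipMatrix_of_coercive hM hα hWt ?_ honet ?_, ?_⟩
  · intro i j hij hadj
    rw [Matrix.add_apply, Matrix.smul_apply, hz i j hij hadj, edgeMatrix_eq_zero hab i j hij hadj]
    simp
  · intro x hx
    rw [hφW]
    have := mul_nonneg ht0 (sq_nonneg (x a - x b))
    have := hlow x hx
    simp only [hφ]
    linarith
  · obtain ⟨x, hx, hxt⟩ := hSc.exists_sSup_image_eq ⟨u, huS.1⟩ (hφt t).continuousOn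
    obtain ⟨y, hy, hyt⟩ := hS₁c.exists_sInf_image_eq ⟨u, huS⟩ (hφt t).continuousOn
    have hquot : χ = top t / bot t := by
      rw [eq_div_iff hbpos.ne']
      linarith [Set.mem_ofPred_eq.mp ht]
    rw [hquot]
    refine hasConditionNumber_of_extremal hM hWt honet hbpos ?_ ?_ hx ((hφW t x).trans hxt.symm)
      hy.1 hy.2 ((hφW t y).trans hyt.symm)
    · intro z
      rw [hφW]
      by_cases hz0 : z = 0
      · simp [hz0, hφ]
      · obtain ⟨s, hs⟩ := exists_normalized hz0
        have h := hle_top t (s • z) hs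
        rw [hscale] at h
        rw [dotProduct_smul, smul_dotProduct, smul_eq_mul, smul_eq_mul, ← mul_assoc, ← sq] at hs
        have hs2 : 0 < s ^ 2 := by
          rcases (sq_nonneg s).eq_or_lt with h0 | h0
          · rw [← h0] at hs; simp at hs
          · exact h0
        refine le_of_mul_le_mul_left ?_ hs2
        calc s ^ 2 * φ t z ≤ top t := h
          _ = s ^ 2 * (top t * (z ⬝ᵥ z)) := by linear_combination (-top t) * hs
    · intro z hz1
      rw [hφW]
      by_cases hz0 : z = 0
      · simp [hz0, hφ]
      · obtain ⟨s, hs⟩ := exists_normalized hz0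
        have h := hbot_le t (s • z) ⟨hs, by
          rw [Set.mem_ofPred_eq, smul_dotProduct, hz1, smul_zero]⟩
        rw [hscale] at h
        rw [dotProduct_smul, smul_dotProduct, smul_eq_mul, smul_eq_mul, ← mul_assoc, ← sq] at hs
        have hs2 : 0 < s ^ 2 := by
          rcases (sq_nonneg s).eq_or_lt with h0 | h0
          · rw [← h0] at hs; simp at hs
          · exact h0
        refine le_of_mul_le_mul_left ?_ hs2
        calc s ^ 2 * (bot t * (z ⬝ᵥ z)) = bot t := by linear_combination (bot t) * hs
          _ ≤ _ := h


/-! ### The networks -/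

/-- Two hubs `m` and `m + 1`; the leaves `j ≤ p` are adjacent to the first one, the leaves
`p ≤ j < m` to the second one. For `m = 1` the graph is completed to a triangle. -/
def network (m p : ℕ) : SimpleGraph (Fin (m + 2)) :=
  SimpleGraph.fromRel fun u v =>
    (u.val = m ∧ v.val ≤ p) ∨ (u.val = m + 1 ∧ p ≤ v.val ∧ v.val < m) ∨ m = 1

lemma network_adj {m p : ℕ} {u v : Fin (m + 2)} : (network m p).Adj u v ↔ u ≠ v ∧
    (((u.val = m ∧ v.val ≤ p) ∨ (u.val = m + 1 ∧ p ≤ v.val ∧ v.val < m) ∨ m = 1) ∨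
      ((v.val = m ∧ u.val ≤ p) ∨ (v.val = m + 1 ∧ p ≤ u.val ∧ u.val < m) ∨ m = 1)) :=
  Iff.rfl

/-- When the connector advances, the first hub gains the new connector and the second hub loses the
old one. The bound on p excludes the triangle. -/
lemma symmDiff_edgeSet_network_subset {m p : ℕ} (hp : p + 1 < m) :
    symmDiff (network m p).edgeSet (network m (p + 1)).edgeSet ⊆
      {s((⟨m, by omega⟩ : Fin (m + 2)), ⟨p + 1, by omega⟩),
        s((⟨m + 1, by omega⟩ : Fin (m + 2)), ⟨p, by omega⟩)} := by
  intro e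
  induction e using Sym2.ind with
  | _ u v =>
    rw [Set.mem_symmDiff, SimpleGraph.mem_edgeSet, SimpleGraph.mem_edgeSet, network_adj,
      network_adj]
    simp only [Set.mem_insert_iff, Set.mem_singleton_iff, Sym2.eq_iff, Fin.ext_iff, ne_eq]
    omega

lemma differInAtMost_network {m p : ℕ} (hp : p + 1 < m) :
    DifferInAtMost 2 (network m p) (network m (p + 1)) :=
  (Set.ncard_le_ncard (symmDiff_edgeSet_network_subset hp) (Set.toFinite _)).trans
    ((Set.ncard_insert_le _ _).trans (by rw [Set.ncard_singleton]))

lemma DifferInAtMost.symm {M r : ℕ} {G H : SimpleGraph (Fin M)} (h : DifferInAtMost r G H) :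
    DifferInAtMost r H G := by
  unfold DifferInAtMost at *
  rwa [symmDiff_comm]

/-- The leaf through which the two hubs are connected in round `k`: it moves to and fro. -/
def connector (m k : ℕ) : ℕ := if Even (k / m) then k % m else m - 1 - k % m

lemma succ_div_mod {m : ℕ} (hm : 0 < m) (k : ℕ) :
    (k % m + 1 < m ∧ (k + 1) / m = k / m ∧ (k + 1) % m = k % m + 1) ∨
      (k % m + 1 = m ∧ (k + 1) / m = k / m + 1 ∧ (k + 1) % m = 0) := by
  have h1 := Nat.mod_lt k hm
  have h2 := Nat.mod_add_div k m
  rcases (Nat.succ_le_of_lt h1).lt_or_eq with h | h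
  · exact Or.inl ⟨h, (Nat.div_mod_unique hm).mpr ⟨by omega, h⟩⟩
  · refine Or.inr ⟨h, (Nat.div_mod_unique hm).mpr ⟨?_, hm⟩⟩
    rw [mul_add, mul_one]
    omega

lemma connector_lt {m : ℕ} (hm : 0 < m) (k : ℕ) : connector m k < m := by
  have := Nat.mod_lt k hm
  unfold connector
  split_ifs <;> omega

/-- The case of equality is the turn between two sweeps, where the connector rests for one round. -/
lemma connector_succ {m : ℕ} (hm : 0 < m) (k : ℕ) :
    connector m (k + 1) = connector m k ∨ connector m (k + 1) = connector m k + 1 ∨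
      connector m (k + 1) + 1 = connector m k := by
  unfold connector
  rcases succ_div_mod hm k with ⟨h1, h2, h3⟩ | ⟨h1, h2, h3⟩
  · rw [h2, h3]
    split_ifs <;> omega
  · rw [h2, h3]
    by_cases he : Even (k / m)
    · rw [if_neg (by simp [Nat.even_add_one, he]), if_pos he]
      omega
    · rw [if_pos (by simp [Nat.even_add_one, he]), if_neg he]
      omega

lemma differInAtMost_network_connector {m : ℕ} (hm : 0 < m) (k : ℕ) :
    DifferInAtMost 2 (network m (connector m k)) (network m (connector m (k + 1))) := by
  have h1 := connector_lt hm k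
  have h2 := connector_lt hm (k + 1)
  rcases connector_succ hm k with h | h | h
  · rw [h]; simp [DifferInAtMost]
  · rw [h] at h2 ⊢
    exact differInAtMost_network h2
  · rw [← h] at h1 ⊢
    exact (differInAtMost_network h1).symm

/-! ### Spectral bounds for the networks. -/

/-- The mean, here 0, minimises the sum of squared deviations. The lower spectral bound takes for s
the value at the connector. -/
lemma dotProduct_self_le_sum_sub_sq {M : ℕ} {x : Fin M → ℝ} (hx : x ⬝ᵥ 1 = 0) (s : ℝ) :
    x ⬝ᵥ x ≤ ∑ v, (x v - s) ^ 2 := by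
  have h1 : ∑ v, x v = 0 := by simpa [dotProduct] using hx
  have h2 : ∑ v, (x v - s) ^ 2 = x ⬝ᵥ x - 2 * s * ∑ v, x v + M * s ^ 2 := by
    simp only [sub_sq, Finset.sum_add_distrib, Finset.sum_sub_distrib, Finset.mul_sum, dotProduct]
    simp only [Finset.sum_const, Finset.card_univ, Fintype.card_fin, nsmul_eq_mul]
    congr 2
    · exact Finset.sum_congr rfl fun v _ => by ring
    · exact Finset.sum_congr rfl fun v _ => by ring
  rw [h2, h1]
  have := mul_nonneg (Nat.cast_nonneg (α := ℝ) M) (sq_nonneg s)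
  linarith

/-- Weights of the edges from the first hub to the leaves. -/
noncomputable def weightLeft (m p j : ℕ) : ℝ := if j < p then 1 else if j = p then m - 1 / 2 else 0

/-- Weights of the edges from the second hub to the leaves. -/
noncomputable def weightRight (m p j : ℕ) : ℝ := if p < j then 1 else if j = p then m - 1 / 2 else 0

/-- A weighted Laplacian of `network m p`. -/
noncomputable def networkLaplacian (m p : ℕ) : Matrix (Fin (m + 2)) (Fin (m + 2)) ℝ :=
  ∑ j : Fin m, (weightLeft m p j • edgeMatrix (Fin.last m).castSucc j.castSucc.castSucc +
    weightRight m p j • edgeMatrix (Fin.last (m + 1)) j.castSucc.castSucc)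

lemma networkLaplacian_quadratic (m p : ℕ) (x : Fin (m + 2) → ℝ) :
    x ⬝ᵥ networkLaplacian m p *ᵥ x = ∑ j : Fin m,
      (weightLeft m p j * (x (Fin.last m).castSucc - x j.castSucc.castSucc) ^ 2 +
        weightRight m p j * (x (Fin.last (m + 1)) - x j.castSucc.castSucc) ^ 2) := by
  simp only [networkLaplacian, sum_mulVec, dotProduct_sum, add_mulVec, smul_mulVec,
    dotProduct_add, dotProduct_smul, edgeMatrix_quadratic, smul_eq_mul]

lemma weightLeft_nonneg {m : ℕ} (hm : 0 < m) (p j : ℕ) : 0 ≤ weightLeft m p j := by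
  have : (1 : ℝ) ≤ m := by exact_mod_cast hm
  unfold weightLeft
  split_ifs <;> linarith

lemma weightRight_nonneg {m : ℕ} (hm : 0 < m) (p j : ℕ) : 0 ≤ weightRight m p j := by
  have : (1 : ℝ) ≤ m := by exact_mod_cast hm
  unfold weightRight
  split_ifs <;> linarith

lemma networkLaplacian_posSemidef {m : ℕ} (hm : 0 < m) (p : ℕ) :
    (networkLaplacian m p).PosSemidef :=
  posSemidef_sum _ fun j _ =>
    ((edgeMatrix_posSemidef _ _).smul (weightLeft_nonneg hm p j)).add
      ((edgeMatrix_posSemidef _ _).smul (weightRight_nonneg hm p j))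

lemma networkLaplacian_mulVec_one (m p : ℕ) : networkLaplacian m p *ᵥ 1 = 0 := by
  simp only [networkLaplacian, sum_mulVec, add_mulVec, smul_mulVec, edgeMatrix_mulVec_one,
    smul_zero, add_zero, Finset.sum_const_zero]

lemma networkLaplacian_eq_zero {m p : ℕ} (i j : Fin (m + 2)) (hij : i ≠ j)
    (hadj : ¬ (network m p).Adj i j) : networkLaplacian m p i j = 0 := by
  rw [networkLaplacian, Matrix.sum_apply]
  refine Finset.sum_eq_zero fun k _ => ?_
  have hk := k.isLt
  have h1 : (weightLeft m p k • edgeMatrix (Fin.last m).castSucc k.castSucc.castSucc) i j = 0 := by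
    rw [Matrix.smul_apply]
    by_cases h : k.val ≤ p
    · rw [edgeMatrix_eq_zero (G := network m p) _ i j hij hadj, smul_zero]
      rw [network_adj]
      refine ⟨?_, Or.inl (Or.inl ⟨by simp, by simpa using h⟩)⟩
      simp only [ne_eq, Fin.ext_iff, Fin.val_castSucc, Fin.val_last]
      omega
    · rw [weightLeft, if_neg (by omega), if_neg (by omega), zero_smul]
  have h2 : (weightRight m p k • edgeMatrix (Fin.last (m + 1)) k.castSucc.castSucc) i j = 0 := by
    rw [Matrix.smul_apply]
    by_cases h : p ≤ k.val
    · rw [edgeMatrix_eq_zero (G := network m p) _ i j hij hadj, smul_zero]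
      rw [network_adj]
      refine ⟨?_, Or.inl (Or.inr (Or.inl ⟨by simp, by simpa using h, by simp⟩))⟩
      simp only [ne_eq, Fin.ext_iff, Fin.val_castSucc, Fin.val_last]
      omega
    · rw [weightRight, if_neg (by omega), if_neg (by omega), zero_smul]
  rw [Matrix.add_apply, h1, h2, add_zero]

lemma dotProduct_self_eq_sum_leaves {m : ℕ} (x : Fin (m + 2) → ℝ) :
    x ⬝ᵥ x = ∑ j : Fin m, x j.castSucc.castSucc ^ 2 + x (Fin.last m).castSucc ^ 2 +
      x (Fin.last (m + 1)) ^ 2 := by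
  simp only [dotProduct, ← sq, Fin.sum_univ_castSucc (n := m + 1), Fin.sum_univ_castSucc (n := m)]

/-- Each edge is split by (a − y)² ≤ 2a² + 2y². The connector, with two edges of weight m − 1/2,
gives exactly the coefficient 4m − 2; the hubs collect at most 2(2m − 3/2) = 4m − 3. -/
lemma networkLaplacian_upper {m p : ℕ} (hm : 2 ≤ m) (hp : p < m) (x : Fin (m + 2) → ℝ) :
    x ⬝ᵥ networkLaplacian m p *ᵥ x ≤ (4 * m - 2) * (x ⬝ᵥ x) := by
  have hm' : (2 : ℝ) ≤ m := by exact_mod_cast hm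
  rw [networkLaplacian_quadratic, dotProduct_self_eq_sum_leaves]
  set a := x (Fin.last m).castSucc
  set b := x (Fin.last (m + 1))
  have hbump : ∑ j : Fin m, ((1 : ℝ) + if j = ⟨p, hp⟩ then (m - 3 / 2 : ℝ) else 0) =
      2 * m - 3 / 2 := by
    rw [Finset.sum_add_distrib, Finset.sum_ite_eq' Finset.univ]
    simp
    ring
  have hterm : ∀ j : Fin m,
      weightLeft m p j * (a - x j.castSucc.castSucc) ^ 2 +
        weightRight m p j * (b - x j.castSucc.castSucc) ^ 2 ≤
      (1 + if j = ⟨p, hp⟩ then (m - 3 / 2 : ℝ) else 0) * (2 * (a ^ 2 + b ^ 2)) +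
        (4 * m - 2) * x j.castSucc.castSucc ^ 2 := by
    intro j
    generalize x j.castSucc.castSucc = y
    have h1 : (a - y) ^ 2 ≤ 2 * a ^ 2 + 2 * y ^ 2 := by nlinarith [sq_nonneg (a + y)]
    have h2 : (b - y) ^ 2 ≤ 2 * b ^ 2 + 2 * y ^ 2 := by nlinarith [sq_nonneg (b + y)]
    have ha := sq_nonneg a
    have hb := sq_nonneg b
    have hy : 0 ≤ ((m : ℝ) - 2) * y ^ 2 := mul_nonneg (by linarith) (sq_nonneg y)
    rcases lt_trichotomy j.val p with h | h | h
    · rw [weightLeft, weightRight, if_pos h, if_neg (by omega), if_neg (by omega),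
        if_neg (by rw [Fin.ext_iff]; exact h.ne)]
      linarith [sq_nonneg y]
    · rw [weightLeft, weightRight, if_neg (by omega), if_pos h, if_neg (by omega),
        if_pos (Fin.ext h)]
      have h3 := mul_le_mul_of_nonneg_left (add_le_add h1 h2)
        (by linarith : (0 : ℝ) ≤ m - 1 / 2)
      linarith
    · rw [weightLeft, weightRight, if_neg (by omega), if_neg (by omega), if_pos h,
        if_neg (by rw [Fin.ext_iff]; exact h.ne')]
      linarith [sq_nonneg y]
  calc _ ≤ ∑ j : Fin m, ((1 + if j = ⟨p, hp⟩ then (m - 3 / 2 : ℝ) else 0) *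
          (2 * (a ^ 2 + b ^ 2)) + (4 * m - 2) * x j.castSucc.castSucc ^ 2) :=
        Finset.sum_le_sum fun j _ => hterm j
    _ = (2 * m - 3 / 2) * (2 * (a ^ 2 + b ^ 2)) +
          (4 * m - 2) * ∑ j : Fin m, x j.castSucc.castSucc ^ 2 := by
        rw [Finset.sum_add_distrib, ← Finset.sum_mul, ← Finset.mul_sum, hbump]
    _ ≤ _ := by linarith [sq_nonneg a, sq_nonneg b]

/-- Deviations are measured from the connector. Every other leaf is reached through its hub, at the
price of at most 2D, where D is the sum of the two squared hub deviations. The connector edges yield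
2(m − 1/2)D = 2(m − 1)D + D, which pays for the other m − 1 leaves and for the hubs themselves; this
dictates the weight m − 1/2. -/
lemma networkLaplacian_lower {m p : ℕ} (hp : p < m) {x : Fin (m + 2) → ℝ}
    (hx : x ⬝ᵥ 1 = 0) : 1 / 2 * (x ⬝ᵥ x) ≤ x ⬝ᵥ networkLaplacian m p *ᵥ x := by
  set q : Fin m := ⟨p, hp⟩
  set s := x q.castSucc.castSucc with hs
  have h0 := dotProduct_self_le_sum_sub_sq hx s
  rw [Fin.sum_univ_castSucc (n := m + 1), Fin.sum_univ_castSucc (n := m)] at h0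
  rw [networkLaplacian_quadratic]
  set a := x (Fin.last m).castSucc
  set b := x (Fin.last (m + 1))
  set D := (a - s) ^ 2 + (b - s) ^ 2 with hD
  have hterm : ∀ j : Fin m, (x j.castSucc.castSucc - s) ^ 2 ≤
      2 * (weightLeft m p j * (a - x j.castSucc.castSucc) ^ 2 +
        weightRight m p j * (b - x j.castSucc.castSucc) ^ 2) +
      (1 - if j = q then (m + 1 / 2 : ℝ) else 0) * (2 * D) := by
    intro j
    rcases lt_trichotomy j.val p with h | h | h
    · rw [weightLeft, weightRight, if_pos h, if_neg (by omega), if_neg (by omega),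
        if_neg (by rw [Fin.ext_iff]; exact h.ne), hD]
      generalize x j.castSucc.castSucc = y
      nlinarith [sq_nonneg (2 * a - y - s), sq_nonneg (b - s)]
    · have hj : j = q := Fin.ext h
      rw [weightLeft, weightRight, if_neg (by omega), if_pos h, if_neg (by omega),
        if_pos hj, hj, ← hs, hD]
      linarith
    · rw [weightLeft, weightRight, if_neg (by omega), if_neg (by omega), if_pos h,
        if_neg (by rw [Fin.ext_iff]; exact h.ne'), hD]
      generalize x j.castSucc.castSucc = y
      nlinarith [sq_nonneg (2 * b - y - s), sq_nonneg (a - s)]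
  have hsum := Finset.sum_le_sum fun j (_ : j ∈ Finset.univ) => hterm j
  have hbump : ∑ j : Fin m, ((1 : ℝ) - if j = q then (m + 1 / 2 : ℝ) else 0) = - (1 / 2) := by
    rw [Finset.sum_sub_distrib, Finset.sum_ite_eq' Finset.univ]
    simp
  rw [Finset.sum_add_distrib, ← Finset.mul_sum, ← Finset.sum_mul, hbump] at hsum
  linarith

/-- Each network carries a gossip matrix with any condition number above a linear bound. -/
theorem exists_gossipMatrix_network {m p : ℕ} (hp : p < m) {χ : ℝ} (hχ : 1 ≤ χ)
    (hmχ : 12 * ((m : ℝ) - 1) ≤ χ) :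
    ∃ W, IsGossipMatrix (network m p) W ∧ HasConditionNumber W χ := by
  rcases (by omega : m = 1 ∨ 2 ≤ m) with rfl | hm
  -- Condition number 1 requires a complete graph, whence the triangle for m = 1.
  · have hadj : ∀ i j : Fin 3, i ≠ j → (network 1 p).Adj i j := fun i j h => by
      rw [network_adj]
      exact ⟨h, by simp⟩
    have hquad : ∀ x : Fin 3 → ℝ,
        x ⬝ᵥ (edgeMatrix 0 1 + edgeMatrix 0 2 + edgeMatrix 1 2) *ᵥ x =
          3 * (x ⬝ᵥ x) - (x ⬝ᵥ 1) ^ 2 := by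
      intro x
      rw [add_mulVec, add_mulVec, dotProduct_add, dotProduct_add, edgeMatrix_quadratic,
        edgeMatrix_quadratic, edgeMatrix_quadratic]
      simp only [dotProduct, Fin.sum_univ_three, Pi.one_apply]
      ring
    refine exists_isGossipMatrix_hasConditionNumber (α := 3) (β := 3)
      (W₀ := edgeMatrix 0 1 + edgeMatrix 0 2 + edgeMatrix 1 2) (a := 0) (b := 1) (c := 2)
      (by norm_num) (by linarith) (by linarith)
      (((edgeMatrix_posSemidef _ _).add (edgeMatrix_posSemidef _ _)).add
        (edgeMatrix_posSemidef _ _)) (fun i j h h' => absurd (hadj i j h) h') ?_ ?_ ?_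
      (hadj 0 1 (by decide)) (by decide) (by decide)
    · simp only [add_mulVec, edgeMatrix_mulVec_one, add_zero]
    · intro x hx
      rw [hquad, hx]
      simp
    · intro x
      rw [hquad]
      linarith [sq_nonneg (x ⬝ᵥ 1)]
  -- The ratio (4m − 2)/(1/2) = 8m − 4 is at most 12(m − 1) precisely because m ≥ 2.
  · have hm' : (2 : ℝ) ≤ m := by exact_mod_cast hm
    refine exists_isGossipMatrix_hasConditionNumber (α := 1 / 2) (β := 4 * m - 2)
      (W₀ := networkLaplacian m p) (a := ⟨m, by omega⟩) (b := ⟨p, by omega⟩) (c := ⟨m + 1, by omega⟩)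
      (by norm_num) (by linarith) (by linarith) (networkLaplacian_posSemidef (by omega) p)
      networkLaplacian_eq_zero (networkLaplacian_mulVec_one m p)
      (fun x hx => networkLaplacian_lower hp hx) (networkLaplacian_upper hm hp) ?_ ?_ ?_
    · rw [network_adj]
      refine ⟨?_, Or.inl (Or.inl ⟨rfl, le_rfl⟩)⟩
      rw [ne_eq, Fin.ext_iff]
      exact hp.ne'
    · rw [ne_eq, Fin.ext_iff]; simp
    · rw [ne_eq, Fin.ext_iff]; simp only; omega


/-! ### Bilinear saddle functions -/

/-- A bilinear saddle function with quadratic regularization. -/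
noncomputable def bilinear {n : ℕ} (μ : ℝ) (A : E n →L[ℝ] E n) (a b : E n) (x y : E n) : ℝ :=
  ⟪x, A y⟫_ℝ + μ / 2 * ‖x‖ ^ 2 - μ / 2 * ‖y‖ ^ 2 + ⟪a, x⟫_ℝ + ⟪b, y⟫_ℝ

lemma hasGradientAt_quadratic {n : ℕ} (c d : ℝ) (v x : E n) :
    HasGradientAt (fun u => c / 2 * ‖u‖ ^ 2 + ⟪v, u⟫_ℝ + d) (c • x + v) x := by
  rw [hasGradientAt_iff_hasFDerivAt]
  have h := ((((hasStrictFDerivAt_norm_sq x).hasFDerivAt.const_mul (c / 2)).add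
    (innerSL ℝ v).hasFDerivAt).add_const d)
  refine h.congr_fderiv ?_
  ext u
  simp
  ring

lemma gradX_bilinear {n : ℕ} (μ : ℝ) (A : E n →L[ℝ] E n) (a b x y : E n) :
    gradX (bilinear μ A a b) x y = A y + μ • x + a := by
  have h := hasGradientAt_quadratic μ (- (μ / 2 * ‖y‖ ^ 2) + ⟪b, y⟫_ℝ) (A y + a) x
  have h2 : (fun u => bilinear μ A a b u y) =
      fun u => μ / 2 * ‖u‖ ^ 2 + ⟪A y + a, u⟫_ℝ + (- (μ / 2 * ‖y‖ ^ 2) + ⟪b, y⟫_ℝ) := by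
    funext u
    rw [bilinear, inner_add_left, real_inner_comm u (A y)]
    ring
  rw [gradX, h2, h.gradient]
  abel

lemma gradY_bilinear {n : ℕ} (μ : ℝ) (A : E n →L[ℝ] E n) (a b x y : E n) :
    gradY (bilinear μ A a b) x y = A.adjoint x - μ • y + b := by
  have h := hasGradientAt_quadratic (-μ) (μ / 2 * ‖x‖ ^ 2 + ⟪a, x⟫_ℝ) (A.adjoint x + b) y
  have h2 : (fun u => bilinear μ A a b x u) =
      fun u => -μ / 2 * ‖u‖ ^ 2 + ⟪A.adjoint x + b, u⟫_ℝ + (μ / 2 * ‖x‖ ^ 2 + ⟪a, x⟫_ℝ) := by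
    funext u
    rw [bilinear, inner_add_left, ContinuousLinearMap.adjoint_inner_left]
    ring
  rw [gradY, h2, h.gradient, neg_smul]
  abel

lemma localOperator_bilinear_sub {n : ℕ} (μ : ℝ) (A : E n →L[ℝ] E n) (a b : E n) (z₁ z₂ : Z n) :
    localOperator (bilinear μ A a b) z₁ - localOperator (bilinear μ A a b) z₂ =
      WithLp.toLp 2 (A (z₁ - z₂).snd + μ • (z₁ - z₂).fst,
        -A.adjoint (z₁ - z₂).fst + μ • (z₁ - z₂).snd) := by
  simp only [localOperator, gradX_bilinear, gradY_bilinear, ← WithLp.toLp_sub, Prod.mk_sub_mk,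
    WithLp.sub_fst, WithLp.sub_snd, map_sub, smul_sub]
  congr 2 <;> abel

/-- The linear part of the operator is μ plus a skew map, so the cross terms cancel and the squared
norms add. This is why L² is compared with C² + μ² and not L with C + μ. -/
lemma norm_localOperator_bilinear_sub_le {n : ℕ} {μ C L : ℝ} {A : E n →L[ℝ] E n} (a b : E n)
    (hC : ‖A‖ ≤ C) (hL : 0 ≤ L) (hCL : C ^ 2 + μ ^ 2 ≤ L ^ 2) (z₁ z₂ : Z n) :
    ‖localOperator (bilinear μ A a b) z₁ - localOperator (bilinear μ A a b) z₂‖ ≤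
      L * ‖z₁ - z₂‖ := by
  rw [localOperator_bilinear_sub]
  set z := z₁ - z₂
  refine le_of_sq_le_sq ?_ (by positivity)
  rw [mul_pow, WithLp.prod_norm_sq_eq_of_L2, WithLp.prod_norm_sq_eq_of_L2 z]
  have h1 : ‖A z.snd‖ ≤ C * ‖z.snd‖ :=
    (A.le_opNorm _).trans (mul_le_mul_of_nonneg_right hC (norm_nonneg _))
  have h2 : ‖A.adjoint z.fst‖ ≤ C * ‖z.fst‖ := by
    refine (A.adjoint.le_opNorm _).trans (mul_le_mul_of_nonneg_right ?_ (norm_nonneg _))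
    rwa [LinearIsometryEquiv.norm_map]
  have h3 := pow_le_pow_left₀ (norm_nonneg _) h1 2
  have h4 := pow_le_pow_left₀ (norm_nonneg _) h2 2
  have h5 : ⟪A z.snd, μ • z.fst⟫_ℝ = μ * ⟪z.snd, A.adjoint z.fst⟫_ℝ := by
    rw [inner_smul_right, ContinuousLinearMap.adjoint_inner_right]
  have h6 : ⟪-A.adjoint z.fst, μ • z.snd⟫_ℝ = - (μ * ⟪z.snd, A.adjoint z.fst⟫_ℝ) := by
    rw [inner_smul_right, inner_neg_left, real_inner_comm]
    ring
  change ‖A z.snd + μ • z.fst‖ ^ 2 + ‖-A.adjoint z.fst + μ • z.snd‖ ^ 2 ≤ _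
  rw [norm_add_sq_real, norm_add_sq_real, h5, h6, norm_neg, norm_smul, norm_smul, mul_pow, mul_pow,
    Real.norm_eq_abs, sq_abs]
  have h7 := mul_le_mul_of_nonneg_right hCL
    (add_nonneg (sq_nonneg ‖z.fst‖) (sq_nonneg ‖z.snd‖))
  linarith

lemma inner_localOperator_bilinear_sub {n : ℕ} (μ : ℝ) (A : E n →L[ℝ] E n) (a b : E n)
    (z₁ z₂ : Z n) :
    ⟪localOperator (bilinear μ A a b) z₁ - localOperator (bilinear μ A a b) z₂, z₁ - z₂⟫_ℝ =
      μ * ‖z₁ - z₂‖ ^ 2 := by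
  rw [localOperator_bilinear_sub]
  set z := z₁ - z₂
  rw [WithLp.prod_inner_apply, WithLp.prod_norm_sq_eq_of_L2]
  change ⟪A z.snd + μ • z.fst, z.fst⟫_ℝ + ⟪-A.adjoint z.fst + μ • z.snd, z.snd⟫_ℝ = _
  simp only [inner_add_left, inner_neg_left, inner_smul_left, real_inner_self_eq_norm_sq,
    ContinuousLinearMap.adjoint_inner_left, RCLike.conj_to_real]
  rw [real_inner_comm z.fst (A z.snd)]
  ring

lemma differentiable_bilinear {n : ℕ} (μ : ℝ) (A : E n →L[ℝ] E n) (a b : E n) :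
    Differentiable ℝ (fun z : E n × E n => bilinear μ A a b z.1 z.2) := by
  have h1 : Differentiable ℝ (fun z : E n × E n => ‖z.1‖ ^ 2) := differentiable_fst.norm_sq ℝ
  have h2 : Differentiable ℝ (fun z : E n × E n => ‖z.2‖ ^ 2) := differentiable_snd.norm_sq ℝ
  have h3 : Differentiable ℝ (fun z : E n × E n => ⟪z.1, A z.2⟫_ℝ) :=
    differentiable_fst.inner ℝ (A.differentiable.comp differentiable_snd)
  have h4 : Differentiable ℝ (fun z : E n × E n => ⟪a, z.1⟫_ℝ) :=
    (differentiable_const a).inner ℝ differentiable_fst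
  have h5 : Differentiable ℝ (fun z : E n × E n => ⟪b, z.2⟫_ℝ) :=
    (differentiable_const b).inner ℝ differentiable_snd
  exact (((h3.add (h1.const_mul _)).sub (h2.const_mul _)).add h4).add h5

/-- The average of bilinear saddle functions. -/
lemma globalObjective_bilinear {M n : ℕ} (hM : M ≠ 0) (μ : ℝ) (A : Fin M → E n →L[ℝ] E n)
    (a b : Fin M → E n) :
    globalObjective (fun m => bilinear μ (A m) (a m) (b m)) =
      bilinear μ ((1 / (M : ℝ)) • ∑ m, A m) ((1 / (M : ℝ)) • ∑ m, a m)
        ((1 / (M : ℝ)) • ∑ m, b m) := by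
  have hM' : (M : ℝ) ≠ 0 := by exact_mod_cast hM
  funext x y
  simp only [globalObjective, bilinear, Finset.sum_add_distrib, Finset.sum_sub_distrib,
    Finset.sum_const, Finset.card_univ, Fintype.card_fin, nsmul_eq_mul,
    _root_.smul_apply, _root_.sum_apply, inner_smul_left,
    inner_smul_right, sum_inner, inner_sum, RCLike.conj_to_real]
  field_simp

lemma globalOperator_bilinear {M n : ℕ} (hM : M ≠ 0) (μ : ℝ) (A : Fin M → E n →L[ℝ] E n)
    (a b : Fin M → E n) :
    globalOperator (fun m => bilinear μ (A m) (a m) (b m)) =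
      localOperator (bilinear μ ((1 / (M : ℝ)) • ∑ m, A m) ((1 / (M : ℝ)) • ∑ m, a m)
        ((1 / (M : ℝ)) • ∑ m, b m)) := by
  have hM' : (M : ℝ) ≠ 0 := by exact_mod_cast hM
  have hcancel : ∀ v : E n, (1 / (M : ℝ)) • (M : ℝ) • v = v := fun v => by
    rw [smul_smul, one_div, inv_mul_cancel₀ hM', one_smul]
  funext z
  simp only [globalOperator, localOperator, gradX_bilinear, gradY_bilinear, ← WithLp.toLp_sum,
    ← WithLp.toLp_smul, map_smul, map_sum, _root_.smul_apply,
    _root_.sum_apply]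
  congr 1
  refine Prod.ext ?_ ?_
  · simp only [Prod.smul_fst, Prod.fst_sum, Finset.sum_add_distrib, Finset.sum_const,
      Finset.card_univ, Fintype.card_fin, smul_add, ← Nat.cast_smul_eq_nsmul ℝ, hcancel,
      WithLp.toLp_smul, WithLp.toLp_sum, WithLp.toLp_ofLp]
  · simp only [Prod.smul_snd, Prod.snd_sum, Finset.sum_add_distrib, Finset.sum_const,
      Finset.sum_neg_distrib, Finset.sum_sub_distrib, smul_neg, smul_sub,
      Finset.card_univ, Fintype.card_fin, smul_add, ← Nat.cast_smul_eq_nsmul ℝ, hcancel,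
      WithLp.toLp_smul, WithLp.toLp_sum, WithLp.toLp_ofLp]

lemma isRegular_bilinear {M n : ℕ} (hM : M ≠ 0) {μ L C : ℝ} (A : Fin M → E n →L[ℝ] E n)
    (a b : Fin M → E n) (hC : ‖(1 / (M : ℝ)) • ∑ m, A m‖ ≤ C) (hL : 0 ≤ L)
    (hCL : C ^ 2 + μ ^ 2 ≤ L ^ 2) : IsRegular (fun m => bilinear μ (A m) (a m) (b m)) L μ where
  differentiable m := differentiable_bilinear _ _ _ _
  smooth z₁ z₂ := by
    rw [globalOperator_bilinear hM]
    exact norm_localOperator_bilinear_sub_le _ _ hC hL hCL z₁ z₂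
  smooth_local := by
    have hS : 0 ≤ ∑ i, ‖A i‖ := Finset.sum_nonneg fun i _ => norm_nonneg _
    refine ⟨∑ i, ‖A i‖ + |μ|, fun m z₁ z₂ => ?_⟩
    refine norm_localOperator_bilinear_sub_le _ _ (C := ∑ i, ‖A i‖)
      (Finset.single_le_sum (f := fun i => ‖A i‖) (fun i _ => norm_nonneg _) (Finset.mem_univ m))
      (by positivity) ?_ z₁ z₂
    rw [add_sq, sq_abs]
    have : 0 ≤ 2 * (∑ i, ‖A i‖) * |μ| := by positivity
    linarith
  strongly_monotone z₁ z₂ := by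
    rw [globalOperator_bilinear hM, inner_localOperator_bilinear_sub]

lemma bilinear_add_left {n : ℕ} (μ : ℝ) (A : E n →L[ℝ] E n) (a b x y u : E n) :
    bilinear μ A a b (x + u) y =
      bilinear μ A a b x y + ⟪A y + μ • x + a, u⟫_ℝ + μ / 2 * ‖u‖ ^ 2 := by
  simp only [bilinear, norm_add_sq_real, inner_add_left, inner_add_right, inner_smul_left,
    RCLike.conj_to_real]
  rw [real_inner_comm u (A y)]
  ring

lemma bilinear_add_right {n : ℕ} (μ : ℝ) (A : E n →L[ℝ] E n) (a b x y u : E n) :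
    bilinear μ A a b x (y + u) =
      bilinear μ A a b x y + ⟪A.adjoint x - μ • y + b, u⟫_ℝ - μ / 2 * ‖u‖ ^ 2 := by
  simp only [bilinear, norm_add_sq_real, inner_add_left, inner_sub_left, inner_add_right,
    inner_smul_left, RCLike.conj_to_real, map_add, ContinuousLinearMap.adjoint_inner_left]
  ring

lemma isSaddlePoint_of_stationary {M n : ℕ} {f : Problem M n} {μ : ℝ} (hμ : 0 ≤ μ)
    {A : E n →L[ℝ] E n} {a b xs ys : E n} (hf : globalObjective f = bilinear μ A a b)
    (hx : A ys + μ • xs + a = 0) (hy : A.adjoint xs - μ • ys + b = 0) :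
    IsSaddlePoint f xs ys := by
  intro x y
  rw [hf]
  constructor
  · have h := bilinear_add_right μ A a b xs ys (y - ys)
    rw [add_sub_cancel, hy, inner_zero_left] at h
    have := mul_nonneg hμ (sq_nonneg ‖y - ys‖)
    linarith
  · have h := bilinear_add_left μ A a b xs ys (x - xs)
    rw [add_sub_cancel, hx, inner_zero_left] at h
    have := mul_nonneg hμ (sq_nonneg ‖x - xs‖)
    linarith

/-! ### The shift operator -/

/-- The `i`-th coordinate, or `0` beyond the dimension. -/
noncomputable def coord {n : ℕ} (x : E n) (i : ℕ) : ℝ := if h : i < n then x ⟨i, h⟩ else 0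

/-- The shift `y ↦ (0, y₀, …, y_{n-2})`. -/
noncomputable def shift (n : ℕ) : E n →L[ℝ] E n :=
  LinearMap.toContinuousLinearMap
    { toFun := fun y => WithLp.toLp 2 fun i => if i.val = 0 then 0 else coord y (i.val - 1)
      map_add' := fun x y => by
        ext i
        simp only [coord, PiLp.add_apply]
        split_ifs <;> simp
      map_smul' := fun c x => by
        ext i
        simp only [coord, PiLp.smul_apply, smul_eq_mul, RingHom.id_apply]
        split_ifs <;> simp }

/-- The backward shift `x ↦ (x₁, …, x_{n-1}, 0)`. -/
noncomputable def backShift (n : ℕ) : E n →L[ℝ] E n :=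
  LinearMap.toContinuousLinearMap
    { toFun := fun y => WithLp.toLp 2 fun i => coord y (i.val + 1)
      map_add' := fun x y => by
        ext i
        simp only [coord, PiLp.add_apply]
        split_ifs <;> simp
      map_smul' := fun c x => by
        ext i
        simp only [coord, PiLp.smul_apply, smul_eq_mul, RingHom.id_apply]
        split_ifs <;> simp }

lemma shift_apply {n : ℕ} (y : E n) (i : Fin n) :
    shift n y i = if i.val = 0 then 0 else coord y (i.val - 1) := rfl

lemma backShift_apply {n : ℕ} (x : E n) (i : Fin n) : backShift n x i = coord x (i.val + 1) := rfl

lemma adjoint_shift (n : ℕ) : (shift n).adjoint = backShift n := by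
  symm
  rw [ContinuousLinearMap.eq_adjoint_iff]
  intro x y
  simp only [PiLp.inner_apply, shift_apply, backShift_apply]
  cases n with
  | zero => simp
  | succ k =>
    rw [Fin.sum_univ_castSucc, Fin.sum_univ_succ]
    simp [coord]
    rfl

lemma norm_shift_le (n : ℕ) : ‖shift n‖ ≤ 1 := by
  refine ContinuousLinearMap.opNorm_le_bound _ zero_le_one fun y => ?_
  rw [one_mul]
  refine le_of_sq_le_sq ?_ (norm_nonneg _)
  rw [EuclideanSpace.norm_sq_eq, EuclideanSpace.norm_sq_eq]
  simp only [shift_apply]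
  cases n with
  | zero => simp
  | succ k =>
    rw [Fin.sum_univ_succ, Fin.sum_univ_castSucc (fun i => ‖y i‖ ^ 2)]
    have h : ∀ i : Fin k, coord y i = y i.castSucc := fun i => by
      rw [coord, dif_pos (by omega)]; rfl
    simp [h]
    positivity


/-! ### Propagation of information -/

/-- The vectors `x` whose coordinates `i` with `2 i ≥ B` vanish. -/
def levelX (n B : ℕ) : Submodule ℝ (E n) where
  carrier := {x | ∀ i, B ≤ 2 * i → coord x i = 0}
  zero_mem' := fun i _ => by simp [coord]
  add_mem' := fun {x y} hx hy i hi => by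
    have h1 := hx i hi
    have h2 := hy i hi
    unfold coord at *
    split_ifs at * <;> simp_all
  smul_mem' := fun c x hx i hi => by
    have h1 := hx i hi
    unfold coord at *
    split_ifs at * <;> simp_all

/-- The vectors `y` whose coordinates `i` with `2 i + 1 ≥ B` vanish. -/
def levelY (n B : ℕ) : Submodule ℝ (E n) where
  carrier := {x | ∀ i, B ≤ 2 * i + 1 → coord x i = 0}
  zero_mem' := fun i _ => by simp [coord]
  add_mem' := fun {x y} hx hy i hi => by
    have h1 := hx i hi
    have h2 := hy i hi
    unfold coord at *
    split_ifs at * <;> simp_all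
  smul_mem' := fun c x hx i hi => by
    have h1 := hx i hi
    unfold coord at *
    split_ifs at * <;> simp_all

lemma levelX_mono (n : ℕ) : Monotone (levelX n) := fun _ _ h _ hx i hi => hx i (h.trans hi)

lemma levelY_mono (n : ℕ) : Monotone (levelY n) := fun _ _ h _ hx i hi => hx i (h.trans hi)

lemma Communicates.subset_of_mono {M n : ℕ} {G : SimpleGraph (Fin M)} {S S' : Fin M → Set (E n)}
    (h : Communicates G S S') {V : ℕ → Submodule ℝ (E n)} (hV : Monotone V) {B B' : Fin M → ℕ}
    (hself : ∀ v, B v ≤ B' v) (hadj : ∀ u v, G.Adj v u → B u ≤ B' v)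
    (hS : ∀ v, S v ⊆ V (B v)) (v : Fin M) : S' v ⊆ V (B' v) := by
  refine (h v).2.trans (Submodule.span_le.mpr (Set.union_subset ?_ ?_))
  · exact (hS v).trans (hV (hself v))
  · exact Set.iUnion₂_subset fun u hu => (hS u).trans (hV (hadj u v hu))

/-- If `B k v` bounds the information of node `v` before round `k` in a way that is compatible
with local iterations and communication rounds, then all memories obey the bound. -/
theorem BBP.memory_subset {M n : ℕ} {G : ℕ → SimpleGraph (Fin M)} {f : Problem M n}
    (B : ℕ → Fin M → ℕ)
    (hlocal : ∀ k v x y, x ∈ levelX n (B k v) → y ∈ levelY n (B k v) →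
      gradX (f v) x y ∈ levelX n (B k v) ∧ gradY (f v) x y ∈ levelY n (B k v))
    (hself : ∀ k v, B k v ≤ B (k + 1) v)
    (hadj : ∀ k u v, (G k).Adj v u → B k u ≤ B (k + 1) v)
    {T K : ℕ} {s : Memory M n} (h : BBP G f T K s) :
    (∀ v, s.memX v ⊆ levelX n (B K v)) ∧ (∀ v, s.memY v ⊆ levelY n (B K v)) := by
  induction h with
  | initial => simp [Memory.initial]
  | @localStep T K s s' _ hstep ih =>
    obtain ⟨ihX, ihY⟩ := ih
    refine ⟨fun v => ?_, fun v => ?_⟩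
    · obtain ⟨X, Y, hX, -, hX', -⟩ := hstep v
      rw [hX]
      refine Set.union_subset (ihX v) fun x hx => ?_
      obtain ⟨x', hx', x'', hx'', y'', hy'', hmem⟩ := hX' x hx
      refine (Submodule.span_le.mpr ?_) hmem
      rintro z (rfl | rfl)
      · exact ihX v hx'
      · exact (hlocal K v _ _ (ihX v hx'') (ihY v hy'')).1
    · obtain ⟨X, Y, -, hY, -, hY'⟩ := hstep v
      rw [hY]
      refine Set.union_subset (ihY v) fun y hy => ?_
      obtain ⟨y', hy', x'', hx'', y'', hy'', hmem⟩ := hY' y hy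
      refine (Submodule.span_le.mpr ?_) hmem
      rintro z (rfl | rfl)
      · exact ihY v hy'
      · exact (hlocal K v _ _ (ihX v hx'') (ihY v hy'')).2
  | @commStep T K s s' _ hstep ih =>
    exact ⟨hstep.1.subset_of_mono (levelX_mono n) (hself K) (hadj K) ih.1,
      hstep.2.subset_of_mono (levelY_mono n) (hself K) (hadj K) ih.2⟩

/-! ### Information crossing the network. -/

/-- The bound on the information of node `v` before round `k`. -/
def infoBound (m k : ℕ) (v : Fin (m + 2)) : ℕ :=
  k / m + if (Even (k / m) ∧ (v.val = m ∨ v.val < k % m)) ∨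
    (¬ Even (k / m) ∧ (v.val = m + 1 ∨ (m - 1 - k % m < v.val ∧ v.val < m))) then 1 else 0

lemma infoBound_le (m k : ℕ) (v : Fin (m + 2)) : infoBound m k v ≤ k / m + 1 := by
  unfold infoBound
  split_ifs <;> omega

/-- In an even sweep the first hub and the leaves below k % m are one step ahead. Round k lets the
first hub inform the leaves up to k % m, while the second hub listens only to leaves from k % m on,
none of which is ahead yet. Odd sweeps are the mirror image. The case v = u covers nodes that keep
their memory. -/
lemma infoBound_succ_of_adj_or_eq {m : ℕ} (hm : 0 < m) (k : ℕ) (u v : Fin (m + 2))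
    (h : v = u ∨ (network m (connector m k)).Adj v u) : infoBound m k u ≤ infoBound m (k + 1) v := by
  have hk := Nat.mod_lt k hm
  have hu := u.isLt
  have hv := v.isLt
  rw [network_adj, ne_eq, Fin.ext_iff] at h
  unfold connector at h
  unfold infoBound
  rcases succ_div_mod hm k with ⟨h1, h2, h3⟩ | ⟨h1, h2, h3⟩
  · rw [h2, h3]
    by_cases he : Even (k / m)
    · simp only [he, if_true, true_and, not_true, false_and, or_false] at h ⊢
      split_ifs <;> omega
    · simp only [he, if_false, false_and, not_false_iff, true_and, false_or] at h ⊢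
      split_ifs <;> omega
  -- At a turn the base level of the new sweep equals the top level of the old one.
  · rw [h2]
    split_ifs <;> omega

/-- Parity tells which hub is stuck: after an odd number of unlocked coordinates the next one is a
y, which the shift cannot supply; after an even number it is an x, which the identity cannot supply.
-/
lemma infoBound_left {m : ℕ} (k : ℕ) (v : Fin (m + 2)) (hv : v.val = m) :
    infoBound m k v % 2 = 1 := by
  unfold infoBound
  by_cases he : Even (k / m)
  · rw [if_pos (Or.inl ⟨he, Or.inl hv⟩)]
    rw [Nat.even_iff] at he
    omega
  · rw [if_neg (by simp [he]; omega)]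
    rw [Nat.not_even_iff] at he
    omega

lemma infoBound_right {m : ℕ} (hm : 0 < m) (k : ℕ) (v : Fin (m + 2)) (hv : v.val = m + 1) :
    infoBound m k v % 2 = 0 := by
  have hk := Nat.mod_lt k hm
  unfold infoBound
  by_cases he : Even (k / m)
  · rw [if_neg (by simp [he]; omega)]
    rw [Nat.even_iff] at he
    omega
  · rw [if_pos (Or.inr ⟨he, Or.inl hv⟩)]
    rw [Nat.not_even_iff] at he
    omega

/-! ### The hard problem -/

lemma coord_eq {n : ℕ} (x : E n) {i : ℕ} (h : i < n) : coord x i = x ⟨i, h⟩ := dif_pos h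

lemma coord_of_le {n : ℕ} (x : E n) {i : ℕ} (h : n ≤ i) : coord x i = 0 := dif_neg (by omega)

/-- The shift feeds x_i from y_{i−1}, one place earlier in the chain. For odd B, 2i ≥ B forces 2(i −
1) + 1 ≥ B when i > 0, so nothing new is unlocked. -/
lemma shift_mem_levelX {n B : ℕ} {y : E n} (hB : B % 2 = 1) (hy : y ∈ levelY n B) :
    shift n y ∈ levelX n B := by
  intro i hi
  by_cases h : i < n
  · rw [coord_eq _ h, shift_apply]
    simp only
    split_ifs with h0
    · rfl
    · exact hy (i - 1) (by omega)
  · exact coord_of_le _ (by omega)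

lemma backShift_mem_levelY {n B : ℕ} {x : E n} (hx : x ∈ levelX n B) :
    backShift n x ∈ levelY n B := by
  intro i hi
  by_cases h : i < n
  · rw [coord_eq _ h, backShift_apply]
    exact hx (i + 1) (by omega)
  · exact coord_of_le _ (by omega)

lemma mem_levelX_of_mem_levelY {n B : ℕ} {y : E n} (hy : y ∈ levelY n B) : y ∈ levelX n B :=
  fun i hi => hy i (by omega)

lemma mem_levelY_of_mem_levelX {n B : ℕ} {x : E n} (hB : B % 2 = 0) (hx : x ∈ levelX n B) :
    x ∈ levelY n B :=
  fun i hi => hx i (by omega)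

/-- The coupling matrices: the hubs hold the two diagonals of a bidiagonal matrix. -/
noncomputable def coupling (m n : ℕ) (ρ : ℝ) (v : Fin (m + 2)) : E n →L[ℝ] E n :=
  (if v = Fin.last (m + 1) then (((m + 2 : ℕ) : ℝ) * ρ) • ContinuousLinearMap.id ℝ (E n) else 0) +
    if v = (Fin.last m).castSucc then (-(((m + 2 : ℕ) : ℝ) * ρ)) • shift n else 0

/-- The linear terms: only the first hub has one. -/
noncomputable def linearTerm (m : ℕ) {n : ℕ} (a : E n) (v : Fin (m + 2)) : E n :=
  if v = (Fin.last m).castSucc then ((m + 2 : ℕ) : ℝ) • a else 0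

/-- The hard problem. -/
noncomputable def hardProblem (m : ℕ) {n : ℕ} (μ ρ : ℝ) (a : E n) : Problem (m + 2) n :=
  fun v => bilinear μ (coupling m n ρ v) (linearTerm m a v) 0

lemma average_coupling (m n : ℕ) (ρ : ℝ) :
    (1 / ((m + 2 : ℕ) : ℝ)) • ∑ v, coupling m n ρ v =
      ρ • (ContinuousLinearMap.id ℝ (E n) - shift n) := by
  have h : ((m + 2 : ℕ) : ℝ) ≠ 0 := by positivity
  simp only [coupling, Finset.sum_add_distrib, Finset.sum_ite_eq', Finset.mem_univ, if_true]
  rw [smul_add, smul_smul, smul_smul, smul_sub, sub_eq_add_neg, ← neg_smul]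
  congr 2 <;> field_simp

lemma average_linearTerm (m : ℕ) {n : ℕ} (a : E n) :
    (1 / ((m + 2 : ℕ) : ℝ)) • ∑ v, linearTerm m a v = a := by
  have h : ((m + 2 : ℕ) : ℝ) ≠ 0 := by positivity
  simp only [linearTerm, Finset.sum_ite_eq', Finset.mem_univ, if_true]
  rw [smul_smul, one_div, inv_mul_cancel₀ h, one_smul]

lemma globalObjective_hardProblem (m : ℕ) {n : ℕ} (μ ρ : ℝ) (a : E n) :
    globalObjective (hardProblem m μ ρ a) =
      bilinear μ (ρ • (ContinuousLinearMap.id ℝ (E n) - shift n)) a 0 := by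
  have h := globalObjective_bilinear (Nat.succ_ne_zero (m + 1)) μ (coupling m n ρ)
    (linearTerm m a) (fun _ => 0)
  simp only [Nat.succ_eq_add_one, Finset.sum_const_zero, smul_zero] at h
  rw [average_coupling, average_linearTerm] at h
  exact h

lemma isBilinear_hardProblem (m : ℕ) {n : ℕ} (μ ρ : ℝ) (a : E n) :
    IsBilinear (hardProblem m μ ρ a) μ :=
  fun v => ⟨coupling m n ρ v, linearTerm m a v, 0, fun _ _ => rfl⟩

lemma isRegular_hardProblem (m : ℕ) {n : ℕ} {μ ρ L : ℝ} (a : E n) (hρ : 0 ≤ ρ) (hL : 0 ≤ L)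
    (h : (2 * ρ) ^ 2 + μ ^ 2 ≤ L ^ 2) : IsRegular (hardProblem m μ ρ a) L μ := by
  refine isRegular_bilinear (Nat.succ_ne_zero (m + 1)) (C := 2 * ρ) _ _ _ ?_ hL h
  simp only [Nat.succ_eq_add_one]
  rw [average_coupling, norm_smul, Real.norm_eq_abs, abs_of_nonneg hρ, mul_comm 2 ρ]
  refine mul_le_mul_of_nonneg_left ((norm_sub_le _ _).trans ?_) hρ
  have := norm_shift_le n
  have := ContinuousLinearMap.norm_id_le (𝕜 := ℝ) (E := E n)
  linarith

/-- Local work is useless at every node: each hub is stuck by parity, and the leaves have no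
coupling at all. The linear term is harmless because the level at its hub is odd, hence at least 1.
-/
lemma hardProblem_local {m n : ℕ} (hm : 0 < m) {μ ρ : ℝ} {a : E n} (ha : a ∈ levelX n 1)
    (k : ℕ) (v : Fin (m + 2)) (x y : E n) (hx : x ∈ levelX n (infoBound m k v))
    (hy : y ∈ levelY n (infoBound m k v)) :
    gradX (hardProblem m μ ρ a v) x y ∈ levelX n (infoBound m k v) ∧
      gradY (hardProblem m μ ρ a v) x y ∈ levelY n (infoBound m k v) := by
  rw [hardProblem, gradX_bilinear, gradY_bilinear, add_zero]
  suffices h : coupling m n ρ v y ∈ levelX n (infoBound m k v) ∧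
      linearTerm m a v ∈ levelX n (infoBound m k v) ∧
      (coupling m n ρ v).adjoint x ∈ levelY n (infoBound m k v) from
    ⟨Submodule.add_mem _ (Submodule.add_mem _ h.1 (Submodule.smul_mem _ _ hx)) h.2.1,
      Submodule.sub_mem _ h.2.2 (Submodule.smul_mem _ _ hy)⟩
  by_cases hl : v = (Fin.last m).castSucc
  · have hB := infoBound_left k v (by simp [hl])
    have hr : v ≠ Fin.last (m + 1) := by rw [hl]; simp [Fin.ext_iff]
    rw [coupling, if_neg hr, if_pos hl, zero_add, linearTerm, if_pos hl,
      LinearIsometryEquiv.map_smulₛₗ, adjoint_shift]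
    exact ⟨Submodule.smul_mem _ _ (shift_mem_levelX hB hy),
      Submodule.smul_mem _ _ (levelX_mono n (by omega) ha),
      Submodule.smul_mem _ _ (backShift_mem_levelY hx)⟩
  · rw [coupling, if_neg hl, add_zero, linearTerm, if_neg hl]
    by_cases hr : v = Fin.last (m + 1)
    · have hB := infoBound_right hm k v (by simp [hr])
      rw [if_pos hr, LinearIsometryEquiv.map_smulₛₗ, ContinuousLinearMap.adjoint_id]
      exact ⟨Submodule.smul_mem _ _ (mem_levelX_of_mem_levelY hy), Submodule.zero_mem _,
        Submodule.smul_mem _ _ (mem_levelY_of_mem_levelX hB hx)⟩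
    · rw [if_neg hr, map_zero]
      exact ⟨Submodule.zero_mem _, Submodule.zero_mem _, Submodule.zero_mem _⟩

lemma hardProblem_output {m n : ℕ} (hm : 0 < m) {μ ρ : ℝ} {a : E n} (ha : a ∈ levelX n 1)
    {T K : ℕ} {s : Memory (m + 2) n}
    (h : BBP (fun k => network m (connector m k)) (hardProblem m μ ρ a) T K s)
    {xh yh : E n} (hout : IsOutput s xh yh) : yh ∈ levelY n (K / m + 1) := by
  have hmem := h.memory_subset (infoBound m) (hardProblem_local hm ha)
    (fun k v => infoBound_succ_of_adj_or_eq hm k v v (Or.inl rfl))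
    (fun k u v huv => infoBound_succ_of_adj_or_eq hm k u v (Or.inr huv))
  refine (Submodule.span_le.mpr (Set.iUnion_subset fun v => ?_)) hout.2
  exact (hmem.2 v).trans (levelY_mono n (infoBound_le m K v))


/-! ### The saddle point of the hard problem -/

/-- The `x`-component of the saddle point. -/
noncomputable def saddleX (n : ℕ) (q : ℝ) : E n :=
  WithLp.toLp 2 fun i => q ^ i.val - q ^ (2 * n - i.val)

/-- The `y`-component of the saddle point. -/
noncomputable def saddleY (n : ℕ) (c q : ℝ) : E n :=
  WithLp.toLp 2 fun i => c * (q ^ i.val + q ^ (2 * n - 1 - i.val))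

/-- The linear term of the hard problem. -/
noncomputable def saddleTerm (n : ℕ) (μ ρ c q : ℝ) : E n :=
  WithLp.toLp 2 fun i =>
    if i.val = 0 then -(ρ * saddleY n c q i + μ * saddleX n q i) else 0

lemma saddleTerm_mem_levelX (n : ℕ) (μ ρ c q : ℝ) : saddleTerm n μ ρ c q ∈ levelX n 1 := by
  intro i hi
  by_cases h : i < n
  · rw [coord_eq _ h, saddleTerm]
    exact if_neg (by simp only; omega)
  · exact coord_of_le _ (by omega)

/-- Row 0 holds by the choice of `saddleTerm`. In the other rows, eliminating y leaves a
second-order recurrence in x whose characteristic roots are q and 1/q; `hq` is its characteristic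
equation. -/
lemma saddle_stationaryX {n : ℕ} {μ ρ q : ℝ} (hμ : μ ≠ 0) (hq : ρ ^ 2 * (1 - q) ^ 2 = μ ^ 2 * q) :
    (ρ • (ContinuousLinearMap.id ℝ (E n) - shift n)) (saddleY n (ρ / μ * (1 - q)) q) +
      μ • saddleX n q + saddleTerm n μ ρ (ρ / μ * (1 - q)) q = 0 := by
  ext ⟨i, hi⟩
  simp only [_root_.smul_apply, _root_.sub_apply, ContinuousLinearMap.id_apply, PiLp.add_apply,
    PiLp.smul_apply, PiLp.sub_apply, PiLp.zero_apply, shift_apply, smul_eq_mul, saddleTerm]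
  rcases i with _ | j
  · simp
  · rw [if_neg (Nat.succ_ne_zero j), if_neg (Nat.succ_ne_zero j), coord_eq _ (by omega)]
    simp only [saddleY, saddleX]
    obtain ⟨e, he⟩ : ∃ e, 2 * n = j + e + 2 := ⟨2 * n - (j + 2), by omega⟩
    have h1 : 2 * n - 1 - (j + 1) = e := by omega
    have h2 : 2 * n - 1 - (j + 1 - 1) = e + 1 := by omega
    have h3 : 2 * n - (j + 1) = e + 1 := by omega
    rw [h1, h2, h3, Nat.add_sub_cancel]
    field_simp
    linear_combination (-q ^ j + q ^ e) * hq

lemma saddle_stationaryY {n : ℕ} {μ ρ q : ℝ} (hμ : μ ≠ 0) :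
    (ρ • (ContinuousLinearMap.id ℝ (E n) - shift n)).adjoint (saddleX n q) -
      μ • saddleY n (ρ / μ * (1 - q)) q + 0 = 0 := by
  rw [LinearIsometryEquiv.map_smulₛₗ, map_sub, ContinuousLinearMap.adjoint_id, adjoint_shift]
  ext ⟨i, hi⟩
  simp only [_root_.smul_apply, _root_.sub_apply, ContinuousLinearMap.id_apply,
    PiLp.smul_apply, PiLp.sub_apply, PiLp.zero_apply, backShift_apply, smul_eq_mul,
    RCLike.conj_to_real, add_zero]
  -- The reflected term q^(2n − i) makes the formula vanish at i = n, in agreement with the default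
  -- value 0 of `coord`, so the last row needs no separate treatment.
  have hc : coord (saddleX n q) (i + 1) = q ^ (i + 1) - q ^ (2 * n - (i + 1)) := by
    by_cases h : i + 1 < n
    · exact coord_eq _ h
    · rw [coord_of_le _ (by omega), show i + 1 = n by omega, show 2 * n - n = n by omega, sub_self]
  rw [hc]
  simp only [saddleY, saddleX]
  obtain ⟨e, he⟩ : ∃ e, 2 * n = i + e + 1 := ⟨2 * n - (i + 1), by omega⟩
  rw [show 2 * n - (i + 1) = e by omega, show 2 * n - i = e + 1 by omega,
    show 2 * n - 1 - i = e by omega]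
  field_simp
  ring

lemma saddleX_ne_zero {n : ℕ} (hn : 1 ≤ n) {q : ℝ} (hq0 : 0 ≤ q) (hq1 : q < 1) :
    saddleX n q ≠ 0 := by
  intro h
  have h0 := congrArg (fun x : E n => x ⟨0, hn⟩) h
  simp only [saddleX, PiLp.zero_apply, pow_zero, Nat.sub_zero] at h0
  have := pow_lt_one₀ hq0 hq1 (show 2 * n ≠ 0 by omega)
  linarith

lemma saddleY_ne_zero {n : ℕ} (hn : 1 ≤ n) {c q : ℝ} (hc : 0 < c) (hq0 : 0 < q) :
    saddleY n c q ≠ 0 := by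
  intro h
  have h0 := congrArg (fun x : E n => x ⟨0, hn⟩) h
  simp only [saddleY, PiLp.zero_apply] at h0
  have : 0 < c * (q ^ 0 + q ^ (2 * n - 1 - 0)) := by positivity
  linarith

/-! ### Distance to the saddle point and the rate. -/

lemma norm_saddleY_sq (n : ℕ) (c q : ℝ) :
    ‖saddleY n c q‖ ^ 2 = ∑ i ∈ Finset.range n, (c * (q ^ i + q ^ (2 * n - 1 - i))) ^ 2 := by
  rw [EuclideanSpace.real_norm_sq_eq,
    ← Fin.sum_univ_eq_sum_range (fun i => (c * (q ^ i + q ^ (2 * n - 1 - i))) ^ 2)]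
  rfl

lemma norm_sub_saddleY_sq {n : ℕ} (c q : ℝ) (y : E n) : ‖y - saddleY n c q‖ ^ 2 =
    ∑ i ∈ Finset.range n, (coord y i - c * (q ^ i + q ^ (2 * n - 1 - i))) ^ 2 := by
  rw [EuclideanSpace.real_norm_sq_eq,
    ← Fin.sum_univ_eq_sum_range (fun i => (coord y i - c * (q ^ i + q ^ (2 * n - 1 - i))) ^ 2)]
  refine Finset.sum_congr rfl fun i _ => ?_
  rw [coord_eq _ i.isLt]
  rfl

/-- A vector supported on the first `N ≤ n / 2` coordinates is far from the saddle point. -/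
lemma saddleY_tail {n N B : ℕ} {c q : ℝ} (hq0 : 0 ≤ q) (hq1 : q ≤ 1) (hN : 2 * N ≤ n)
    (hB : B ≤ 2 * N + 1) {y : E n} (hy : y ∈ levelY n B) :
    q ^ (2 * N) / 8 * ‖saddleY n c q‖ ^ 2 ≤ ‖y - saddleY n c q‖ ^ 2 := by
  obtain ⟨r, rfl⟩ : ∃ r, n = N + r := ⟨n - N, by omega⟩
  set S : ℕ → ℝ := fun k => ∑ i ∈ Finset.range k, (q ^ 2) ^ i with hS
  -- Since 2N ≤ n means N ≤ r, the sum fits into two blocks of length r, the second no larger than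
  -- the first. With the factor 4 in `hup` this makes the 8.
  have hS2 : S (N + r) ≤ 2 * S r := by
    calc S (N + r) ≤ S (r + r) :=
          Finset.sum_le_sum_of_subset_of_nonneg
            (Finset.range_subset_range.mpr (by omega)) fun i _ _ => by positivity
      _ = S r + ∑ x ∈ Finset.range r, (q ^ 2) ^ (r + x) := Finset.sum_range_add _ _ _
      _ ≤ S r + S r := by
          exact add_le_add le_rfl (Finset.sum_le_sum fun x _ =>
            pow_le_pow_of_le_one (sq_nonneg q) (pow_le_one₀ hq0 hq1) (by omega))
      _ = 2 * S r := by ring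
  have hup : ‖saddleY (N + r) c q‖ ^ 2 ≤ 4 * c ^ 2 * S (N + r) := by
    rw [norm_saddleY_sq, hS, Finset.mul_sum]
    refine Finset.sum_le_sum fun i hi => ?_
    have hi' := Finset.mem_range.mp hi
    have h1 : q ^ (2 * (N + r) - 1 - i) ≤ q ^ i := pow_le_pow_of_le_one hq0 hq1 (by omega)
    have h2 : (q ^ i + q ^ (2 * (N + r) - 1 - i)) ^ 2 ≤ (2 * q ^ i) ^ 2 :=
      pow_le_pow_left₀ (by positivity) (by linarith) 2
    calc _ = c ^ 2 * (q ^ i + q ^ (2 * (N + r) - 1 - i)) ^ 2 := by ring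
      _ ≤ c ^ 2 * (2 * q ^ i) ^ 2 := mul_le_mul_of_nonneg_left h2 (sq_nonneg c)
      _ = _ := by ring
  have hlow : c ^ 2 * q ^ (2 * N) * S r ≤ ‖y - saddleY (N + r) c q‖ ^ 2 := by
    rw [norm_sub_saddleY_sq, Finset.sum_range_add, hS, Finset.mul_sum]
    refine le_add_of_nonneg_of_le (Finset.sum_nonneg fun i _ => sq_nonneg _)
      (Finset.sum_le_sum fun x _ => ?_)
    rw [hy (N + x) (by omega)]
    have h2 : (q ^ (N + x)) ^ 2 ≤ (q ^ (N + x) + q ^ (2 * (N + r) - 1 - (N + x))) ^ 2 :=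
      pow_le_pow_left₀ (by positivity) (le_add_of_nonneg_right (by positivity)) 2
    calc _ = c ^ 2 * (q ^ (N + x)) ^ 2 := by ring
      _ ≤ _ := mul_le_mul_of_nonneg_left h2 (sq_nonneg c)
      _ = _ := by ring
  have hqN : 0 ≤ q ^ (2 * N) / 8 := by positivity
  calc _ ≤ q ^ (2 * N) / 8 * (4 * c ^ 2 * (2 * S r)) :=
        mul_le_mul_of_nonneg_left
          (hup.trans (mul_le_mul_of_nonneg_left hS2 (by positivity))) hqN
    _ = c ^ 2 * q ^ (2 * N) * S r := by ring
    _ ≤ _ := hlow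

/-- The contraction rate in terms of the number of communication rounds. -/
lemma exp_le_rate {L μ χ : ℝ} (hμ : 0 < μ) (hL : μ < L) (hχ : 0 < χ) {m K : ℕ}
    (hmχ : χ ≤ 12 * m) : Real.exp (-(32 * μ / (L - μ)) * ((K : ℝ) / χ)) ≤
      4 * ((L - μ) / (L + μ)) ^ (2 * ((K / m + 1) / 2)) := by
  have hLμ : 0 < L - μ := sub_pos.mpr hL
  have hLμ' : 0 < L + μ := by linarith
  set P := K / m with hP
  set q := (L - μ) / (L + μ) with hq
  set u := μ / (L - μ) with hu
  have hu0 : 0 < u := div_pos hμ hLμ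
  have hq0 : 0 < q := div_pos hLμ hLμ'
  have hq1 : q ≤ 1 := (div_le_one hLμ').mpr (by linarith)
  -- As q = 1/(1 + 2u), the inequality 1 + s ≤ exp s turns into upper bounds of exponentials by
  -- multiples of q.
  have hqu : q * (1 + 2 * u) = 1 := by rw [hq, hu]; field_simp; ring
  have hbound : ∀ C t : ℝ, 0 < C → 1 + 2 * u ≤ C * Real.exp t → Real.exp (-t) ≤ C * q := by
    intro C t hC h
    have h1 := mul_le_mul_of_nonneg_left h hq0.le
    rw [hqu] at h1
    rw [Real.exp_neg, inv_le_iff_one_le_mul₀ (Real.exp_pos t)]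
    linarith
  have hKP : (m : ℝ) * P ≤ K := by exact_mod_cast Nat.mul_div_le K m
  have hm0 : (0 : ℝ) < m := by linarith
  have hKχ : (P : ℝ) / 12 ≤ K / χ := by
    rw [div_le_div_iff₀ (by norm_num) hχ]
    nlinarith [mul_le_mul_of_nonneg_left hmχ (Nat.cast_nonneg (α := ℝ) P)]
  -- The ratio 32/12 exceeds 5/2: this leaves 2u per sweep for a factor q, and a spare u/2.
  have hexp : -(32 * μ / (L - μ)) * ((K : ℝ) / χ) ≤ -(5 / 2 * u * P) := by
    have h1 : 32 * μ / (L - μ) = 32 * u := by rw [hu]; ring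
    have h2 := mul_le_mul_of_nonneg_left hKχ hu0.le
    have h3 : 0 ≤ u * P := by positivity
    rw [h1]
    linarith
  refine (Real.exp_le_exp.mpr hexp).trans ?_
  -- The exponent 2⌊(P + 1)/2⌋ can be P + 1, one more than the number of sweeps. For P ≥ 1 the spare
  -- u/2 pays for the extra q at the cost of the factor 4; for P = 0 the exponent is 0.
  rcases Nat.eq_zero_or_pos P with h0 | h0
  · rw [h0]
    norm_num
  · have hP1 : (1 : ℝ) ≤ P := by exact_mod_cast h0
    have h1 : Real.exp (-(2 * u)) ≤ q := by
      have := hbound 1 (2 * u) one_pos (by linarith [Real.add_one_le_exp (2 * u)])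
      linarith
    have h2 : Real.exp (-(u / 2)) ≤ 4 * q :=
      hbound 4 (u / 2) (by norm_num) (by linarith [Real.add_one_le_exp (u / 2)])
    calc Real.exp (-(5 / 2 * u * P)) ≤ Real.exp (P * -(2 * u) + -(u / 2)) := by
          rw [Real.exp_le_exp]
          linarith [mul_le_mul_of_nonneg_left hP1 hu0.le]
      _ = Real.exp (-(2 * u)) ^ P * Real.exp (-(u / 2)) := by rw [Real.exp_add, Real.exp_nat_mul]
      _ ≤ q ^ P * (4 * q) := by gcongr
      _ = 4 * q ^ (P + 1) := by ring
      _ ≤ 4 * q ^ (2 * ((P + 1) / 2)) := by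
          gcongr 4 * ?_
          exact pow_le_pow_of_le_one hq0.le hq1 (by omega)

end DecentralizedSaddle

open DecentralizedSaddle

theorem mainTheorem1 :
    ∃ c : ℝ, 0 < c ∧ ∀ L μ χ : ℝ, 0 < μ → μ < L → 1 ≤ χ →
      ∃ (M : ℕ) (G : ℕ → SimpleGraph (Fin M)) (W : ℕ → Matrix (Fin M) (Fin M) ℝ),
        (∀ k, DecentralizedSaddle.DifferInAtMost 2 (G k) (G (k + 1))) ∧
        (∀ k, DecentralizedSaddle.IsGossipMatrix (G k) (W k)) ∧
        (∀ k, DecentralizedSaddle.HasConditionNumber (W k) χ) ∧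
        ∃ (f : ∀ n : ℕ, DecentralizedSaddle.Problem M n)
          (xs ys : ∀ n : ℕ, DecentralizedSaddle.E n),
          (∀ n : ℕ, 1 ≤ n →
            DecentralizedSaddle.IsBilinear (f n) μ ∧
            DecentralizedSaddle.IsRegular (f n) L μ ∧
            DecentralizedSaddle.IsSaddlePoint (f n) (xs n) (ys n) ∧
            xs n ≠ 0 ∧ ys n ≠ 0) ∧
          ∀ K : ℕ, ∃ n₀ : ℕ, ∀ n : ℕ, n₀ ≤ n →
            ∀ (T : ℕ) (s : DecentralizedSaddle.Memory M n),
              DecentralizedSaddle.BBP G (f n) T K s →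
              ∀ xh yh : DecentralizedSaddle.E n, DecentralizedSaddle.IsOutput s xh yh →
                c * (Real.exp (-(32 * μ / (L - μ)) * ((K : ℝ) / χ)) *
                    ‖(0 : DecentralizedSaddle.E n) - ys n‖ ^ 2)
                  ≤ ‖xh - xs n‖ ^ 2 + ‖yh - ys n‖ ^ 2 := by
  -- The 1/32 combines the 1/8 of `saddleY_tail` with the 1/4 from `exp_le_rate`.
  refine ⟨1 / 32, by norm_num, fun L μ χ hμ hL hχ => ?_⟩
  obtain ⟨m, hm⟩ : ∃ m : ℕ, m = ⌈χ / 12⌉₊ := ⟨_, rfl⟩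
  have hm0 : 0 < m := by rw [hm, Nat.ceil_pos]; linarith
  have hmχ : χ ≤ 12 * m := by
    have := Nat.le_ceil (χ / 12)
    rw [← hm] at this
    linarith
  have hχm : 12 * ((m : ℝ) - 1) ≤ χ := by
    have := Nat.ceil_lt_add_one (show 0 ≤ χ / 12 by linarith)
    rw [← hm] at this
    linarith
  have hLμ : 0 < L - μ := sub_pos.mpr hL
  have hLμ' : 0 < L + μ := by linarith
  have hdisc : 0 < L ^ 2 - μ ^ 2 := by nlinarith
  -- The largest ρ allowed by (2ρ)² + μ² ≤ L², where 2 bounds the norm of I − S. It makes q rational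
  -- in L and μ.
  set ρ := √(L ^ 2 - μ ^ 2) / 2 with hρ
  have hρ0 : 0 < ρ := by positivity
  have hρ2 : (2 * ρ) ^ 2 = L ^ 2 - μ ^ 2 := by
    rw [hρ, mul_div_cancel₀ _ two_ne_zero, Real.sq_sqrt hdisc.le]
  set q := (L - μ) / (L + μ) with hq
  have hq0 : 0 < q := div_pos hLμ hLμ'
  have hq1 : q < 1 := (div_lt_one hLμ').mpr (by linarith)
  have hrate : ρ ^ 2 * (1 - q) ^ 2 = μ ^ 2 * q := by
    have h1 : ρ ^ 2 = (L ^ 2 - μ ^ 2) / 4 := by linarith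
    rw [h1, hq]
    field_simp
    ring
  set c := ρ / μ * (1 - q) with hc
  have hc0 : 0 < c := mul_pos (div_pos hρ0 hμ) (sub_pos.mpr hq1)
  choose W hW using fun k => exists_gossipMatrix_network (connector_lt hm0 k) hχ hχm
  refine ⟨m + 2, fun k => network m (connector m k), W, differInAtMost_network_connector hm0,
    fun k => (hW k).1, fun k => (hW k).2, fun n => hardProblem m μ ρ (saddleTerm n μ ρ c q),
    fun n => saddleX n q, fun n => saddleY n c q, fun n hn => ?_, fun K => ⟨K + 1, ?_⟩⟩
  · exact ⟨isBilinear_hardProblem m μ ρ _,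
      isRegular_hardProblem m _ hρ0.le (by linarith) (by linarith),
      isSaddlePoint_of_stationary hμ.le (globalObjective_hardProblem m μ ρ _)
        (saddle_stationaryX hμ.ne' hrate) (saddle_stationaryY hμ.ne'),
      saddleX_ne_zero hn hq0.le hq1, saddleY_ne_zero hn hc0 hq0⟩
  · intro n hn T s hs xh yh hout
    have hKm := Nat.div_le_self K m
    -- Of K/m + 1 unlocked coordinates in the chain, half, rounded down, are y-coordinates. The
    -- choice n ≥ K + 1 ensures 2N ≤ n.
    have htail := saddleY_tail (c := c) hq0.le hq1.le (N := (K / m + 1) / 2) (by omega) (by omega)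
      (hardProblem_output hm0 (saddleTerm_mem_levelX n μ ρ c q) hs hout)
    have hexp := mul_le_mul_of_nonneg_right (exp_le_rate hμ hL (by linarith) (K := K) hmχ)
      (sq_nonneg ‖saddleY n c q‖)
    rw [zero_sub, norm_neg]
    linarith [sq_nonneg ‖xh - saddleX n q‖]
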